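/- Let $\mathcal H$ be a complex Hilbert space and let $A$ be a bounded selfadjoint operator on $\mathcal H$, with resolvent set $\rho(A)$. A Kreĭn space is a complex vector space $\mathcal K$ with a Hermitian sesquilinear form $[\cdot,\cdot]$ that admits a fundamental decomposition, i.e. a direct sum decomposition $\mathcal K=\mathcal K_+\dot+\mathcal K_-$ with $[\mathcal K_+,\mathcal K_-]=0$ such that $(\mathcal K_\pm,\pm[\cdot,\cdot])$ are Hilbert spaces; its topology is that of the norm $\|x_++x_-\|^2=[x_+,x_+]-[x_-,x_-]$ (the norms of different fundamental decompositions are equivalent). A Kreĭn space continuously embedded in $\mathcal H$ is a linear subspace $\mathcal K\subseteq\mathcal H$ together with a form $[\cdot,\cdot]$ on $\mathcal K$ making it a Kreĭn space such that the inclusion $\iota\colon\mathcal K\to\mathcal H$ is bounded. Its adjoint $\iota^\sharp\colon\mathcal H\to\mathcal K$ is defined by $\langle\iota x,y\rangle_{\mathcal H}=[x,\iota^\sharp y]$ for $x\in\mathcal K$, $y\in\mathcal H$. The space $\mathcal K$ is associated to $A$ if $\iota\iota^\sharp=A$. A subspace $\mathcal L\subseteq\mathcal K$ is uniformly positive (respectively,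 uniformly negative) if $\mathcal K=\mathcal L+\mathcal L^\perp$, where $\mathcal L^\perp=\{x\in\mathcal K:[x,y]=0 \text{ for all } y\in\mathcal L\}$, and $[x,x]>0$ (respectively, $[x,x]<0$) for all $x\in\mathcal L\setminus\{0\}$; it is maximal uniformly definite if it is maximal, with respect to inclusion, among the uniformly positive subspaces or maximal among the uniformly negative subspaces of $\mathcal K$. **Corollary 6.2.** The following statements are equivalent: (a) There is a unique Kreĭn space $\mathcal K$ continuously embedded in $\mathcal H$ and associated to $A$ (unique as a linear subspace of $\mathcal H$ together with its form). (b) There exists $\epsilon>0$ such that either $(-\epsilon,0)\subset\rho(A)$ or $(0,\epsilon)\subset\rho(A)$. (c) There exists a Kreĭn space $\mathcal K$ continuously embedded in $\mathcal H$ such that $\iota\iota^\sharp=A$ and $\operatorname{ran}(\iota^\sharp)$ contains a maximal uniformly definite subspace of $\mathcal K$. -/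

import Mathlib

open Filter Topology ComplexConjugate
open scoped InnerProductSpace

/-! Indefinite inner products are sesquilinear forms that are conjugate-linear in the first variable
(Mathlib's convention): the form value `B x y` is the indefinite inner product `[y, x]` in the
convention which is linear in the first variable. -/

namespace Krein

section Abstract

variable {K : Type*} [AddCommGroup K] [Module ℂ K]

/-- The subspace `L`, with the restriction of the form `B` as its inner product, is a Hilbert space:
`B` is positive definite on `L`, and every sequence of `L` that is Cauchy for the norm
`x ↦ (B x x)^(1/2)` converges in that norm to an element of `L`. -/
structure IsHilbertOn (B : K →ₗ⋆[ℂ] K →ₗ[ℂ] ℂ) (L : Submodule ℂ K) : Prop where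
  pos : ∀ x ∈ L, x ≠ 0 → 0 < (B x x).re
  complete : ∀ u : ℕ → K, (∀ n, u n ∈ L) →
    (∀ ε : ℝ, 0 < ε → ∃ N, ∀ m ≥ N, ∀ n ≥ N, √(B (u m - u n) (u m - u n)).re < ε) →
    ∃ x ∈ L, Tendsto (fun n => √(B (u n - x) (u n - x)).re) atTop (𝓝 0)

/-- `K = Kp [∔] Km` is a fundamental decomposition: a direct sum, orthogonal for `B`, such that
`(Kp, B)` and `(Km, -B)` are Hilbert spaces. -/
structure IsFundamentalDecomposition (B : K →ₗ⋆[ℂ] K →ₗ[ℂ] ℂ) (Kp Km : Submodule ℂ K) :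
    Prop where
  isCompl : IsCompl Kp Km
  orthogonal : ∀ x ∈ Kp, ∀ y ∈ Km, B x y = 0
  hilbert_pos : IsHilbertOn B Kp
  hilbert_neg : IsHilbertOn (-B) Km

/-- `(K, B)` is a Kreĭn space: `B` is Hermitian and there is a fundamental decomposition. -/
def IsKreinSpace (B : K →ₗ⋆[ℂ] K →ₗ[ℂ] ℂ) : Prop :=
  B.IsSymm ∧ ∃ Kp Km : Submodule ℂ K, IsFundamentalDecomposition B Kp Km

/-- Boundedness of a linear operator `T` from a Kreĭn space `(K, B)` to a normed space, for the norm
`‖xp + xm‖² = [xp, xp] - [xm, xm]`, where `xp ∈ Kp` and `xm ∈ Km`, of a fundamental decomposition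
`K = Kp [∔] Km`. All these norms are equivalent, so it does not matter which one is used. -/
def IsBoundedOp {H : Type*} [NormedAddCommGroup H] [NormedSpace ℂ H]
    (B : K →ₗ⋆[ℂ] K →ₗ[ℂ] ℂ) (T : K →ₗ[ℂ] H) : Prop :=
  ∃ Kp Km : Submodule ℂ K, IsFundamentalDecomposition B Kp Km ∧
    ∃ C : ℝ, ∀ xp ∈ Kp, ∀ xm ∈ Km, ‖T (xp + xm)‖ ≤ C * √((B xp xp).re - (B xm xm).re)

/-- `L` is a regular subspace of `(K, B)`: `K = L + L^⊥`, with `L^⊥` the orthogonal companion for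
the indefinite inner product. In a Kreĭn space such a subspace is automatically closed. -/
def IsRegular (B : K →ₗ⋆[ℂ] K →ₗ[ℂ] ℂ) (L : Submodule ℂ K) : Prop :=
  L ⊔ L.orthogonalBilin B = ⊤

/-- Uniformly positive subspaces: regular subspaces that are positive. -/
def IsUniformlyPositive (B : K →ₗ⋆[ℂ] K →ₗ[ℂ] ℂ) (L : Submodule ℂ K) : Prop :=
  IsRegular B L ∧ ∀ x ∈ L, x ≠ 0 → 0 < (B x x).re

/-- Uniformly negative subspaces: regular subspaces that are negative. -/
def IsUniformlyNegative (B : K →ₗ⋆[ℂ] K →ₗ[ℂ] ℂ) (L : Submodule ℂ K) : Prop :=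
  IsRegular B L ∧ ∀ x ∈ L, x ≠ 0 → (B x x).re < 0

/-- Maximal uniformly definite subspaces: those that are maximal among the uniformly positive
subspaces, or maximal among the uniformly negative subspaces. -/
def IsMaximalUniformlyDefinite (B : K →ₗ⋆[ℂ] K →ₗ[ℂ] ℂ) (L : Submodule ℂ K) : Prop :=
  Maximal (IsUniformlyPositive B) L ∨ Maximal (IsUniformlyNegative B) L

/-- The Riesz representation theorem on `L`. -/
theorem IsHilbertOn.riesz {B : K →ₗ⋆[ℂ] K →ₗ[ℂ] ℂ} {L : Submodule ℂ K} (h : IsHilbertOn B L)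
    (hB : B.IsSymm) (φ : K →ₗ[ℂ] ℂ) (C : ℝ)
    (hφ : ∀ x ∈ L, ‖φ x‖ ≤ C * √(B x x).re) : ∃ z ∈ L, ∀ x ∈ L, B z x = φ x := by
  let core : InnerProductSpace.Core ℂ L :=
    { inner := fun x y => B x y
      conj_inner_symm := fun x y => hB.eq y x
      re_inner_nonneg := fun x => by
        by_cases hx : (x : K) = 0
        · simp [hx]
        · exact (h.pos x x.2 hx).le
      add_left := fun x y z => by simp
      smul_left := fun x y r => by simp
      definite := fun x hx => by
        by_contra hne
        have h1 := h.pos x x.2 (by simpa using hne)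
        have h2 : B (x : K) (x : K) = 0 := hx
        rw [h2] at h1
        simp at h1 }
  let : NormedAddCommGroup L := core.toNormedAddCommGroup
  let : InnerProductSpace ℂ L := InnerProductSpace.ofCore core.toCore
  have hnorm : ∀ x : L, ‖x‖ = √(B (x : K) (x : K)).re := fun x => rfl
  have : CompleteSpace L := by
    refine Metric.complete_of_cauchySeq_tendsto fun u hu => ?_
    rw [Metric.cauchySeq_iff] at hu
    obtain ⟨x, hxL, hx⟩ := h.complete (fun n => (u n : K)) (fun n => (u n).2) (fun ε hε => by
      obtain ⟨N, hN⟩ := hu ε hε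
      refine ⟨N, fun m hm n hn => ?_⟩
      have := hN m hm n hn
      rw [dist_eq_norm, hnorm] at this
      simpa using this)
    refine ⟨⟨x, hxL⟩, ?_⟩
    rw [tendsto_iff_norm_sub_tendsto_zero]
    refine hx.congr fun n => ?_
    rw [hnorm]
    rfl
  let ψ : L →L[ℂ] ℂ := (φ.comp L.subtype).mkContinuous C (fun x => by
    rw [hnorm]
    exact hφ x x.2)
  refine ⟨((InnerProductSpace.toDual ℂ L).symm ψ : L), Subtype.property _, fun x hx => ?_⟩
  have := InnerProductSpace.toDual_symm_apply (𝕜 := ℂ) (x := (⟨x, hx⟩ : L)) (y := ψ)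
  exact this

/-- A Kreĭn space is nondegenerate. -/
theorem IsKreinSpace.nondegenerate {B : K →ₗ⋆[ℂ] K →ₗ[ℂ] ℂ} (hB : IsKreinSpace B) {y : K}
    (hy : ∀ x, B x y = 0) : y = 0 := by
  obtain ⟨hs, Kp, Km, h⟩ := hB
  obtain ⟨p, hp, m, hm, rfl⟩ : ∃ p ∈ Kp, ∃ m ∈ Km, p + m = y := by
    rw [← Submodule.mem_sup, h.isCompl.sup_eq_top]
    trivial
  have hmp : B m p = 0 := by rw [← hs.eq, h.orthogonal p hp m hm, map_zero]
  have h1 : p = 0 := by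
    by_contra hne
    have h2 := hy p
    rw [map_add, h.orthogonal p hp m hm, add_zero] at h2
    simpa [h2] using h.hilbert_pos.pos p hp hne
  have h2 : m = 0 := by
    by_contra hne
    have h2 := hy m
    rw [map_add, hmp, zero_add] at h2
    simpa [h2] using h.hilbert_neg.pos m hm hne
  rw [h1, h2, add_zero]

/-- A bounded operator `T` from a Kreĭn space to a Hilbert space has a unique adjoint `S`, that is,
`⟪T x, y⟫ = B x (S y)` for all `x` and `y`. -/
theorem existsUnique_sharp {H : Type*} [NormedAddCommGroup H] [InnerProductSpace ℂ H]
    {B : K →ₗ⋆[ℂ] K →ₗ[ℂ] ℂ} (hB : IsKreinSpace B) {T : K →ₗ[ℂ] H} (hT : IsBoundedOp B T) :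
    ∃! S : H →ₗ[ℂ] K, ∀ x y, ⟪T x, y⟫_ℂ = B x (S y) := by
  have huniq : ∀ y z : K, (∀ x, B x y = B x z) → y = z := fun y z hyz =>
    sub_eq_zero.1 (hB.nondegenerate fun x => by rw [map_sub, hyz, sub_self])
  have hex : ∀ y : H, ∃ z : K, ∀ x, ⟪T x, y⟫_ℂ = B x z := by
    intro y
    obtain ⟨Kp, Km, h, C, hC⟩ := hT
    have hs := hB.1
    let φ : K →ₗ[ℂ] ℂ := (innerSL ℂ y).toLinearMap.comp T
    have hφ : ∀ x, φ x = ⟪y, T x⟫_ℂ := fun x => rfl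
    obtain ⟨zp, hzp, hp⟩ := h.hilbert_pos.riesz hs φ (‖y‖ * C) (fun x hx => by
      have h1 := hC x hx 0 Km.zero_mem
      simp only [add_zero, map_zero, Complex.zero_re, sub_zero] at h1
      rw [hφ, mul_assoc]
      exact (norm_inner_le_norm _ _).trans (mul_le_mul_of_nonneg_left h1 (norm_nonneg _)))
    obtain ⟨zm, hzm, hm⟩ := h.hilbert_neg.riesz (⟨fun x y => by simp [← hs.eq x y]⟩) φ (‖y‖ * C)
      (fun x hx => by
      have h1 := hC 0 Kp.zero_mem x hx
      simp only [zero_add, map_zero, Complex.zero_re, zero_sub] at h1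
      rw [hφ, mul_assoc]
      refine (norm_inner_le_norm _ _).trans (mul_le_mul_of_nonneg_left ?_ (norm_nonneg _))
      simpa using h1)
    refine ⟨zp - zm, fun x => ?_⟩
    obtain ⟨p, hpK, m, hmK, rfl⟩ : ∃ p ∈ Kp, ∃ m ∈ Km, p + m = x := by
      rw [← Submodule.mem_sup, h.isCompl.sup_eq_top]
      trivial
    have e1 := hp p hpK
    have e2 := hm m hmK
    have e3 := h.orthogonal zp hzp m hmK
    have e4 : B zm p = 0 := by rw [← hs.eq, h.orthogonal p hpK zm hzm, map_zero]
    rw [← hs.eq, ← inner_conj_symm, ← hφ]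
    congr 1
    simp only [LinearMap.neg_apply] at e2
    simp only [map_add, map_sub, LinearMap.sub_apply, e3, e4, e1, ← e2]
    ring
  choose S hS using hex
  refine ⟨{ toFun := S, map_add' := fun y z => huniq _ _ fun x => ?_,
            map_smul' := fun c y => huniq _ _ fun x => ?_ }, fun x y => hS y x, fun S' hS' => ?_⟩
  · rw [← hS, map_add, ← hS, ← hS, inner_add_right]
  · rw [← hS, RingHom.id_apply, map_smul, ← hS, inner_smul_right, smul_eq_mul]
  · exact LinearMap.ext fun y => huniq _ _ fun x => (hS' x y).symm.trans (hS y x)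

end Abstract

section Embedded

variable {H : Type*} [NormedAddCommGroup H] [InnerProductSpace ℂ H]

variable (H) in
/-- A Kreĭn space continuously embedded in `H`: a linear subspace of `H` with an indefinite inner
product that makes it a Kreĭn space and for which the inclusion into `H` is bounded. Two of them are
equal exactly when they have the same underlying subspace and the same indefinite inner product. -/
structure EmbeddedKreinSpace where
  carrier : Submodule ℂ H
  form : carrier →ₗ⋆[ℂ] carrier →ₗ[ℂ] ℂ
  isKrein : IsKreinSpace form
  bounded : IsBoundedOp form carrier.subtype

namespace EmbeddedKreinSpace

/-- The embedding operator `ι : K → H`. -/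
def ι (𝒦 : EmbeddedKreinSpace H) : 𝒦.carrier →ₗ[ℂ] H := 𝒦.carrier.subtype

/-- The adjoint `ι^♯ : H → K` of the embedding operator, characterised by
`⟪ι x, y⟫ = 𝒦.form x (ι^♯ y)`. -/
noncomputable def ιSharp (𝒦 : EmbeddedKreinSpace H) : H →ₗ[ℂ] 𝒦.carrier :=
  (existsUnique_sharp 𝒦.isKrein 𝒦.bounded).choose

theorem ιSharp_spec (𝒦 : EmbeddedKreinSpace H) (x : 𝒦.carrier) (y : H) :
    ⟪𝒦.ι x, y⟫_ℂ = 𝒦.form x (𝒦.ιSharp y) :=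
  (existsUnique_sharp 𝒦.isKrein 𝒦.bounded).choose_spec.1 x y

/-- `𝒦` is associated to `A`: `ι ι^♯ = A`. -/
def IsAssociated (𝒦 : EmbeddedKreinSpace H) (A : H →L[ℂ] H) : Prop :=
  𝒦.ι ∘ₗ 𝒦.ιSharp = (A : H →ₗ[ℂ] H)

end EmbeddedKreinSpace

end Embedded

end Krein

/-! A fundamental decomposition of a Kreĭn space embedded in `H` amounts to two bounded operators T
: E → H and S : F → H on Hilbert spaces, jointly injective, and then ι ι^♯ = T T† - S S†. The
question is thus how far A = T T† - S S† determines the embedded space. Changing the sign of A and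
of the form exchanges the two definite parts, so one sign suffices in (b) and (c).

(c) implies (a), `eq_of_maximal_le_range`: if L is maximal uniformly positive and L ⊆ ran ι^♯, its
embedding T factors as T = A R. In any other associated space 𝒦' the map ι'^♯ R is an isometric copy
of L with the same image in `H`. The form of ι^♯ w with itself is ⟪w, A w⟫ in both spaces, so the
negativity of L^⊥ carries over, by density, to the companion of the copy. Both spaces then have the
same T, hence the same S S†, and S S† determines the Hilbert space embedded by S
(`exists_eq_of_comp_adjoint_eq`).

(b) implies (c), `exists_maximal_le_range_of_gap`: take for T and S the square roots of the positive
and negative parts of A, off their kernels. A gap (0, ε) makes the first root a product A q(A), so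
the positive component lies in ran ι^♯.

(a) implies (b), `exists_ne_of_accumulation`: if the spectrum accumulates at 0 from both sides,
there are orthonormal sequences e_n and f_n with T e_n and S f_n tiny. Hyperbolic rotations by the
angle n in the planes of e_n and f_n preserve T T† - S S† and perturb T and S summably. Being
unbounded as a family, they change the subspace (`exists_range_ne_of_orthonormal`). -/

namespace Krein

universe u

/-! ### Definite subspaces as Hilbert spaces, and the Hilbert space behind a Kreĭn space -/

section Abstract

variable {K : Type u} [AddCommGroup K] [Module ℂ K]

theorem isSymm_neg {B : K →ₗ⋆[ℂ] K →ₗ[ℂ] ℂ} (hB : B.IsSymm) : (-B).IsSymm :=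
  ⟨fun x y => by simp [← hB.eq x y]⟩

theorem im_self_eq_zero {B : K →ₗ⋆[ℂ] K →ₗ[ℂ] ℂ} (hB : B.IsSymm) (x : K) : (B x x).im = 0 :=
  Complex.conj_eq_iff_im.1 (hB.eq x x)

/-- A subspace that is a Hilbert space for the form is the isometric image of a Hilbert space. -/
theorem IsHilbertOn.exists_realization {B : K →ₗ⋆[ℂ] K →ₗ[ℂ] ℂ} {L : Submodule ℂ K}
    (h : IsHilbertOn B L) (hB : B.IsSymm) :
    ∃ (E : Type u) (_ : NormedAddCommGroup E) (_ : InnerProductSpace ℂ E) (_ : CompleteSpace E)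
      (f : E →ₗ[ℂ] K), (∀ x y, B (f x) (f y) = ⟪x, y⟫_ℂ) ∧ LinearMap.range f = L := by
  let core : InnerProductSpace.Core ℂ L :=
    { inner := fun x y => B x y
      conj_inner_symm := fun x y => hB.eq y x
      re_inner_nonneg := fun x => by
        by_cases hx : (x : K) = 0
        · simp [hx]
        · exact (h.pos x x.2 hx).le
      add_left := fun x y z => by simp
      smul_left := fun x y r => by simp
      definite := fun x hx => by
        by_contra hne
        have h1 := h.pos x x.2 (by simpa using hne)
        have h2 : B (x : K) (x : K) = 0 := hx
        rw [h2] at h1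
        simp at h1 }
  let iN : NormedAddCommGroup L := core.toNormedAddCommGroup
  let iI : InnerProductSpace ℂ L := InnerProductSpace.ofCore core.toCore
  have hnorm : ∀ x : L, ‖x‖ = √(B (x : K) (x : K)).re := fun x => rfl
  have iC : CompleteSpace L := by
    refine Metric.complete_of_cauchySeq_tendsto fun u hu => ?_
    rw [Metric.cauchySeq_iff] at hu
    obtain ⟨x, hxL, hx⟩ := h.complete (fun n => (u n : K)) (fun n => (u n).2) (fun ε hε => by
      obtain ⟨N, hN⟩ := hu ε hε
      refine ⟨N, fun m hm n hn => ?_⟩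
      have := hN m hm n hn
      rw [dist_eq_norm, hnorm] at this
      simpa using this)
    refine ⟨⟨x, hxL⟩, ?_⟩
    rw [tendsto_iff_norm_sub_tendsto_zero]
    refine hx.congr fun n => ?_
    rw [hnorm]
    rfl
  exact ⟨L, iN, iI, iC, L.subtype, fun x y => rfl, L.range_subtype⟩

variable {E F : Type*} [NormedAddCommGroup E] [InnerProductSpace ℂ E]
  [NormedAddCommGroup F] [InnerProductSpace ℂ F]

theorem norm_eq_sqrt_form {B : K →ₗ⋆[ℂ] K →ₗ[ℂ] ℂ} {f : E →ₗ[ℂ] K}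
    (hf : ∀ x y, B (f x) (f y) = ⟪x, y⟫_ℂ) (x : E) : ‖x‖ = √(B (f x) (f x)).re := by
  rw [hf, inner_self_eq_norm_sq_to_K]
  norm_cast
  exact (Real.sqrt_sq (norm_nonneg x)).symm

theorem re_form_eq_norm_sq {B : K →ₗ⋆[ℂ] K →ₗ[ℂ] ℂ} {f : E →ₗ[ℂ] K}
    (hf : ∀ x y, B (f x) (f y) = ⟪x, y⟫_ℂ) (x : E) : (B (f x) (f x)).re = ‖x‖ ^ 2 := by
  rw [hf, inner_self_eq_norm_sq_to_K]
  norm_cast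

theorem injective_of_form_eq_inner {B : K →ₗ⋆[ℂ] K →ₗ[ℂ] ℂ} {f : E →ₗ[ℂ] K}
    (hf : ∀ x y, B (f x) (f y) = ⟪x, y⟫_ℂ) : Function.Injective f := by
  refine (injective_iff_map_eq_zero f).2 fun x hx => ?_
  have := hf x x
  rw [hx, map_zero] at this
  exact inner_self_eq_zero.1 this.symm

/-- The isometric image of a Hilbert space is a Hilbert space for the form. -/
theorem isHilbertOn_range [CompleteSpace E] {B : K →ₗ⋆[ℂ] K →ₗ[ℂ] ℂ} {f : E →ₗ[ℂ] K}
    (hf : ∀ x y, B (f x) (f y) = ⟪x, y⟫_ℂ) : IsHilbertOn B (LinearMap.range f) where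
  pos := by
    rintro _ ⟨x, rfl⟩ hx
    rw [re_form_eq_norm_sq hf]
    have : x ≠ 0 := by rintro rfl; simp at hx
    positivity
  complete := by
    intro v hv hc
    choose w hw using hv
    have hd : ∀ m x, √(B (v m - f x) (v m - f x)).re = dist (w m) x := fun m x => by
      rw [← hw, ← map_sub, ← norm_eq_sqrt_form hf, dist_eq_norm]
    have hcau : CauchySeq w := Metric.cauchySeq_iff.2 fun ε hε => by
      obtain ⟨N, hN⟩ := hc ε hε
      refine ⟨N, fun m hm n hn => ?_⟩
      rw [← hd, hw]
      exact hN m hm n hn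
    obtain ⟨x, hx⟩ := cauchySeq_tendsto_of_complete hcau
    refine ⟨f x, ⟨x, rfl⟩, ?_⟩
    simp only [hd]
    exact tendsto_iff_dist_tendsto_zero.1 hx

/-- A Kreĭn space described as the sum of isometric images of a Hilbert space and of an anti-Hilbert
space. -/
structure IsModel (B : K →ₗ⋆[ℂ] K →ₗ[ℂ] ℂ) (f : E →ₗ[ℂ] K) (g : F →ₗ[ℂ] K) : Prop where
  sup_eq_top : LinearMap.range f ⊔ LinearMap.range g = ⊤
  pos : ∀ x y, B (f x) (f y) = ⟪x, y⟫_ℂ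
  neg : ∀ x y, (-B) (g x) (g y) = ⟪x, y⟫_ℂ
  orthogonal : ∀ x y, B (f x) (g y) = 0

namespace IsModel

variable {B : K →ₗ⋆[ℂ] K →ₗ[ℂ] ℂ} {f : E →ₗ[ℂ] K} {g : F →ₗ[ℂ] K}

theorem orthogonal' (h : IsModel B f g) (hB : B.IsSymm) (x : F) (y : E) : B (g x) (f y) = 0 := by
  rw [← hB.eq, h.orthogonal, map_zero]

theorem form_apply (h : IsModel B f g) (hB : B.IsSymm) (x x' : E) (y y' : F) :
    B (f x + g y) (f x' + g y') = ⟪x, x'⟫_ℂ - ⟪y, y'⟫_ℂ := by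
  have := h.neg y y'
  simp only [LinearMap.neg_apply] at this
  simp [h.pos, h.orthogonal, h.orthogonal' hB, ← this]

theorem exists_add (h : IsModel B f g) (k : K) : ∃ x y, f x + g y = k := by
  obtain ⟨_, ⟨x, rfl⟩, _, ⟨y, rfl⟩, hxy⟩ :=
    Submodule.mem_sup.1 (h.sup_eq_top ▸ Submodule.mem_top : k ∈ _ ⊔ _)
  exact ⟨x, y, hxy⟩

theorem isCompl (h : IsModel B f g) :
    IsCompl (LinearMap.range f) (LinearMap.range g) := by
  refine ⟨Submodule.disjoint_def.2 ?_, codisjoint_iff.2 h.sup_eq_top⟩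
  rintro _ ⟨x, rfl⟩ ⟨y, hy⟩
  have : ⟪x, x⟫_ℂ = 0 := by rw [← h.pos, ← hy, hy, ← h.orthogonal x y, hy]
  rw [inner_self_eq_zero.1 this, map_zero]

theorem isFundamentalDecomposition [CompleteSpace E] [CompleteSpace F] (h : IsModel B f g) :
    IsFundamentalDecomposition B (LinearMap.range f) (LinearMap.range g) where
  isCompl := h.isCompl
  orthogonal := by
    rintro _ ⟨x, rfl⟩ _ ⟨y, rfl⟩
    exact h.orthogonal x y
  hilbert_pos := isHilbertOn_range h.pos
  hilbert_neg := isHilbertOn_range h.neg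

end IsModel

/-- The Hilbert space inner product `⟪x, y⟫ = B (J x) y` given by a fundamental decomposition. -/
theorem IsFundamentalDecomposition.exists_hilbert {B : K →ₗ⋆[ℂ] K →ₗ[ℂ] ℂ}
    {Kp Km : Submodule ℂ K} (h : IsFundamentalDecomposition B Kp Km) (hB : B.IsSymm) :
    ∃ (X : Type u) (_ : NormedAddCommGroup X) (_ : InnerProductSpace ℂ X) (_ : CompleteSpace X)
      (e : X ≃ₗ[ℂ] K) (J : X →L[ℂ] X), (∀ x, J (J x) = x) ∧
      (∀ x y, B (e x) (e y) = ⟪J x, y⟫_ℂ) ∧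
      ∀ x ∈ Kp, ∀ y ∈ Km, ‖e.symm (x + y)‖ ^ 2 = (B x x).re - (B y y).re := by
  obtain ⟨E, _, _, _, f, hf, rfl⟩ := h.hilbert_pos.exists_realization hB
  obtain ⟨F, _, _, _, g, hg, rfl⟩ := h.hilbert_neg.exists_realization (isSymm_neg hB)
  have hm : IsModel B f g :=
    ⟨h.isCompl.sup_eq_top, hf, hg, fun x y => h.orthogonal _ ⟨x, rfl⟩ _ ⟨y, rfl⟩⟩
  let φ : WithLp 2 (E × F) →ₗ[ℂ] K :=
    (f.coprod g).comp (WithLp.linearEquiv 2 ℂ (E × F)).toLinearMap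
  have hφ : ∀ x, φ x = f x.fst + g x.snd := fun x => rfl
  have hinj : Function.Injective φ := by
    refine (injective_iff_map_eq_zero φ).2 fun x hx => ?_
    -- The form is indefinite, so pairing a kernel vector with itself is not enough; it is paired
    -- with each component separately.
    have h1 := hm.form_apply hB x.fst x.fst x.snd 0
    have h2 := hm.form_apply hB x.fst 0 x.snd x.snd
    rw [← hφ, hx] at h1 h2
    simp only [map_zero, LinearMap.zero_apply, inner_zero_right, sub_zero,
      zero_sub] at h1 h2
    have h3 : x.fst = 0 := inner_self_eq_zero.1 h1.symm
    have h4 : x.snd = 0 := inner_self_eq_zero.1 (neg_eq_zero.1 h2.symm)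
    exact WithLp.ofLp_injective 2 (Prod.ext h3 h4)
  have hsurj : Function.Surjective φ := fun k => by
    obtain ⟨x, y, hxy⟩ := hm.exists_add k
    exact ⟨WithLp.toLp 2 (x, y), hxy⟩
  let e : WithLp 2 (E × F) ≃ₗ[ℂ] K := LinearEquiv.ofBijective φ ⟨hinj, hsurj⟩
  -- The fundamental symmetry: identity on E, minus identity on F.
  let J : WithLp 2 (E × F) →L[ℂ] WithLp 2 (E × F) :=
    ((WithLp.prodContinuousLinearEquiv 2 ℂ E F).symm : E × F →L[ℂ] WithLp 2 (E × F)) ∘L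
      ((ContinuousLinearMap.id ℂ E).prodMap (-ContinuousLinearMap.id ℂ F)) ∘L
      (WithLp.prodContinuousLinearEquiv 2 ℂ E F : WithLp 2 (E × F) →L[ℂ] E × F)
  have hJ : ∀ x, J x = WithLp.toLp 2 (x.fst, -x.snd) := fun x => rfl
  refine ⟨WithLp 2 (E × F), inferInstance, inferInstance, inferInstance, e, J, fun x => ?_,
    fun x y => ?_, ?_⟩
  · simp [hJ]
    rfl
  · have : B (e x) (e y) = B (f x.fst + g x.snd) (f y.fst + g y.snd) := rfl
    rw [this, hm.form_apply hB, hJ, WithLp.prod_inner_apply]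
    simp [sub_eq_add_neg]
  · rintro _ ⟨x, rfl⟩ _ ⟨y, rfl⟩
    have : e.symm (f x + g y) = WithLp.toLp 2 (x, y) := by
      rw [LinearEquiv.symm_apply_eq]
      rfl
    rw [this, WithLp.prod_norm_sq_eq_of_L2]
    have h2 := re_form_eq_norm_sq hm.neg y
    have h1 := re_form_eq_norm_sq hm.pos x
    simp only [LinearMap.neg_apply, Complex.neg_re] at h2
    simp [h1, ← h2, sub_eq_add_neg]

end Abstract

/-! ### Norm comparison, closedness and density through the fundamental symmetry -/

section Hilbert

variable {K : Type*} [AddCommGroup K] [Module ℂ K] {B : K →ₗ⋆[ℂ] K →ₗ[ℂ] ℂ}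
  {X : Type*} [NormedAddCommGroup X] [InnerProductSpace ℂ X] [CompleteSpace X]
  {e : X ≃ₗ[ℂ] K} {J : X →L[ℂ] X}

/-- In a Kreĭn space the norm given by an arbitrary orthogonal decomposition into a positive and a
negative subspace dominates the Hilbert space norms. -/
theorem exists_norm_sq_le (hB : B.IsSymm) (hJ : ∀ x, J (J x) = x)
    (hBJ : ∀ x y, B (e x) (e y) = ⟪J x, y⟫_ℂ) {L N : Submodule ℂ K} (hLN : IsCompl L N)
    (horth : ∀ x ∈ L, ∀ y ∈ N, B x y = 0) (hpos : ∀ x ∈ L, 0 ≤ (B x x).re)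
    (hneg : ∀ x ∈ N, (B x x).re ≤ 0) :
    (∃ M : ℝ, 0 < M ∧
      ∀ x ∈ L, ∀ y ∈ N, ‖e.symm (x + y)‖ ^ 2 ≤ M * ((B x x).re - (B y y).re)) ∧
      IsClosed (e ⁻¹' L) ∧ IsClosed (e ⁻¹' N) := by
  let P := L.projection N hLN
  -- The symmetry of the decomposition: 1 on L and -1 on N. Its boundedness is not given and is the
  -- main point.
  let R : K →ₗ[ℂ] K := (2 : ℂ) • P - LinearMap.id
  have horth' : ∀ x ∈ N, ∀ y ∈ L, B x y = 0 := fun x hx y hy => by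
    rw [← hB.eq, horth y hy x hx, map_zero]
  have hPL : ∀ x, P x ∈ L := fun x => Submodule.projection_apply_mem hLN x
  have hPN : ∀ x, x - P x ∈ N := fun x => Submodule.sub_projection_mem hLN x
  have hR : ∀ x, R x = P x - (x - P x) := fun x => by
    simp only [R, LinearMap.sub_apply, LinearMap.id_apply, two_smul, LinearMap.add_apply]
    abel
  have hP1 : ∀ x ∈ L, P x = x := fun x hx => Submodule.projection_apply_of_mem_left hLN hx
  have hP0 : ∀ x ∈ N, P x = 0 := fun x hx => (Submodule.projection_apply_eq_zero_iff hLN).2 hx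
  have hRR : ∀ x, R (R x) = x := fun x => by
    rw [hR (R x), hR x, map_sub, hP1 _ (hPL x), hP0 _ (hPN x)]
    abel
  have hPB : ∀ x y, B (P x) y = B x (P y) := fun x y => by
    have h1 := horth _ (hPL x) _ (hPN y)
    have h2 := horth' _ (hPN x) _ (hPL y)
    rw [map_sub, sub_eq_zero] at h1
    rw [map_sub, LinearMap.sub_apply, sub_eq_zero] at h2
    rw [h1, h2]
  have hRB : ∀ x y, B (R x) y = B x (R y) := fun x y => by
    simp only [R, LinearMap.sub_apply, LinearMap.id_apply, two_smul, LinearMap.add_apply, map_sub,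
      map_add, hPB]
  have hJs : ∀ x y, ⟪J x, y⟫_ℂ = ⟪x, J y⟫_ℂ := fun x y => by
    rw [← hBJ, ← hB.eq, hBJ, inner_conj_symm]
  let RX : X →ₗ[ℂ] X := e.symm.toLinearMap ∘ₗ R ∘ₗ e.toLinearMap
  have hRX : ∀ x, e (RX x) = R (e x) := fun x => e.apply_symm_apply _
  have hRXB : ∀ x y, ⟪J (RX x), y⟫_ℂ = ⟪J x, RX y⟫_ℂ := fun x y => by
    rw [← hBJ, ← hBJ, hRX, hRX, hRB]
  have hRXX : ∀ x, RX (RX x) = x := fun x => e.injective (by rw [hRX, hRX, hRR])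
  -- R is symmetric for B, so R J is symmetric for the Hilbert inner product. Being defined
  -- everywhere, it is bounded by Hellinger–Toeplitz, and R follows since J² = 1.
  have hsymm : (RX ∘ₗ J.toLinearMap).IsSymmetric := fun x y => by
    simp only [LinearMap.comp_apply, ContinuousLinearMap.coe_coe]
    rw [← hJ (RX (J x)), hJs, hRXB, hJ]
  have hcont : Continuous (RX ∘ₗ J.toLinearMap) := hsymm.continuous
  have hRXc : Continuous RX := by
    have : (RX : X → X) = (RX ∘ₗ J.toLinearMap) ∘ J := by
      ext x
      simp [hJ]
    rw [this]
    exact hcont.comp J.continuous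
  let S : X →L[ℂ] X := ⟨RX ∘ₗ J.toLinearMap, hcont⟩
  refine ⟨⟨‖S‖ + 1, by positivity, fun x hx y hy => ?_⟩, ?_, ?_⟩
  · set z := e.symm (x + y) with hz
    have hez : e z = x + y := e.apply_symm_apply _
    set M := ‖S‖ + 1 with hM
    have hM0 : 0 < M := by positivity
    have key : ∀ w, 0 ≤ (⟪J (RX w), w⟫_ℂ).re := fun w => by
      rw [← hBJ, hRX, hR]
      have h1 := hpos _ (hPL (e w))
      have h2 := hneg _ (hPN (e w))
      have h3 := horth _ (hPL (e w)) _ (hPN (e w))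
      have h4 := horth' _ (hPN (e w)) _ (hPL (e w))
      have : B (P (e w) - (e w - P (e w))) (e w)
          = B (P (e w)) (P (e w)) - B (e w - P (e w)) (e w - P (e w)) := by
        rw [map_sub, LinearMap.sub_apply] at h4
        simp only [map_sub, LinearMap.sub_apply] at h3 ⊢
        linear_combination h3 - h4
      rw [this, Complex.sub_re]
      linarith
    have hz1 : (⟪J (RX z), z⟫_ℂ).re = (B x x).re - (B y y).re := by
      rw [← hBJ, hRX, hez, hR, map_add P, hP1 x hx, hP0 y hy]
      simp [horth x hx y hy, horth' y hy x hx]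
    have hS : ∀ w, S w = RX (J w) := fun w => rfl
    -- With q(w) = Re ⟪J R w, w⟫ ≥ 0 and J R S = 1, this test vector gives q(z) - 2 M⁻¹ ‖z‖² + M⁻²
    -- Re ⟪z, S z⟫ ≥ 0. The last term is at most M⁻¹ ‖z‖², which leaves M⁻¹ ‖z‖² ≤ q(z).
    have h0 := key (z - ((M⁻¹ : ℝ) : ℂ) • S z)
    have hSz : J (RX (S z)) = z := by rw [hS, hRXX, hJ]
    have e1 : (⟪J (RX z), S z⟫_ℂ).re = ‖z‖ ^ 2 := by
      rw [hRXB, hS, hRXX, hJs, hJ, inner_self_eq_norm_sq_to_K]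
      norm_cast
    have e2 : (⟪z, z⟫_ℂ).re = ‖z‖ ^ 2 := by
      rw [inner_self_eq_norm_sq_to_K]
      norm_cast
    have e3 : (⟪z, S z⟫_ℂ).re ≤ M * ‖z‖ ^ 2 := by
      refine (Complex.re_le_norm _).trans ((norm_inner_le_norm _ _).trans ?_)
      have := S.le_opNorm z
      nlinarith [norm_nonneg z]
    simp only [map_sub, map_smul, inner_sub_left, inner_sub_right, inner_smul_left,
      inner_smul_right, hSz, Complex.conj_ofReal, Complex.sub_re, Complex.re_ofReal_mul, e1, e2,
      hz1] at h0
    have e4 : M⁻¹ * (M⁻¹ * (⟪z, S z⟫_ℂ).re) ≤ M⁻¹ * ‖z‖ ^ 2 := by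
      gcongr
      rw [inv_mul_le_iff₀ hM0]
      exact e3
    have e5 : M⁻¹ * ‖z‖ ^ 2 ≤ (B x x).re - (B y y).re := by linarith
    rwa [inv_mul_le_iff₀ hM0] at e5
  · have : (e ⁻¹' (L : Set K)) = {x | RX x = x} := by
      ext x
      simp only [Set.mem_preimage, SetLike.mem_coe, Set.mem_ofPred_eq]
      rw [← e.injective.eq_iff, hRX, hR]
      constructor
      · intro h
        rw [hP1 _ h]; abel
      · intro h
        have h2 : (2 : ℂ) • (P (e x) - e x) = 0 := by
          rw [two_smul]; nth_rewrite 4 [← h]; abel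
        have h3 : P (e x) = e x := by
          simpa [sub_eq_zero] using h2
        rw [← h3]
        exact hPL _
    rw [this]
    exact isClosed_eq hRXc continuous_id
  · have : (e ⁻¹' (N : Set K)) = {x | RX x = -x} := by
      ext x
      simp only [Set.mem_preimage, SetLike.mem_coe, Set.mem_ofPred_eq]
      rw [← e.injective.eq_iff, hRX, hR, map_neg]
      constructor
      · intro h
        rw [hP0 _ h]; abel
      · intro h
        have h2 : (2 : ℂ) • P (e x) = 0 := by
          rw [two_smul, ← neg_add_cancel (e x), ← h]; abel
        exact (Submodule.projection_apply_eq_zero_iff hLN).1 ((smul_eq_zero.1 h2).resolve_left two_ne_zero)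
    rw [this]
    exact isClosed_eq hRXc continuous_neg

/-- A positive subspace that is closed and on which the norm is dominated by the form is a Hilbert
space for the form. -/
theorem isHilbertOn_of_norm_sq_le (hBJ : ∀ x y, B (e x) (e y) = ⟪J x, y⟫_ℂ) {L : Submodule ℂ K}
    (hL : IsClosed (e ⁻¹' L)) {M : ℝ} (hM : 0 < M)
    (h : ∀ x ∈ L, ‖e.symm x‖ ^ 2 ≤ M * (B x x).re) : IsHilbertOn B L where
  pos x hx hx0 := by
    have h1 := h x hx
    have h2 : e.symm x ≠ 0 := by simpa using hx0
    have h3 : 0 < ‖e.symm x‖ ^ 2 := by positivity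
    exact pos_of_mul_pos_right (h3.trans_le h1) hM.le
  complete v hv hc := by
    have hle : ∀ x ∈ L, ‖e.symm x‖ ≤ √M * √(B x x).re := fun x hx => by
      rw [← Real.sqrt_mul hM.le]
      exact Real.le_sqrt_of_sq_le (h x hx)
    have hle2 : ∀ x, √(B x x).re ≤ √‖J‖ * ‖e.symm x‖ := fun x => by
      rw [← Real.sqrt_sq (norm_nonneg (e.symm x)), ← Real.sqrt_mul (norm_nonneg _)]
      refine Real.sqrt_le_sqrt ?_
      have h1 := hBJ (e.symm x) (e.symm x)
      rw [e.apply_symm_apply] at h1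
      rw [h1]
      refine (Complex.re_le_norm _).trans ((norm_inner_le_norm _ _).trans ?_)
      rw [sq, ← mul_assoc]
      gcongr
      exact J.le_opNorm _
    have hcau : CauchySeq fun n => e.symm (v n) := Metric.cauchySeq_iff.2 fun ε hε => by
      obtain ⟨n₀, hn₀⟩ := hc (ε / √M) (by positivity)
      refine ⟨n₀, fun m hm n hn => ?_⟩
      rw [dist_eq_norm, ← map_sub]
      refine (hle _ (L.sub_mem (hv m) (hv n))).trans_lt ?_
      rw [mul_comm, ← lt_div_iff₀ (by positivity)]
      exact hn₀ m hm n hn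
    obtain ⟨x, hx⟩ := cauchySeq_tendsto_of_complete hcau
    refine ⟨e x, hL.mem_of_tendsto hx (Eventually.of_forall fun n => by simpa using hv n), ?_⟩
    have h1 : Tendsto (fun n => √‖J‖ * ‖e.symm (v n) - x‖) atTop (𝓝 0) := by
      simpa using (tendsto_iff_norm_sub_tendsto_zero.1 hx).const_mul √‖J‖
    refine squeeze_zero (fun n => Real.sqrt_nonneg _) (fun n => ?_) h1
    simpa using hle2 (v n - e x)

/-- If `M` is dense in `N` in the weak sense and the form is nonpositive on `M`, then it is
nonpositive on `N`. -/
theorem form_nonpos_of_dense (hJ : ∀ x, J (J x) = x)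
    (hBJ : ∀ x y, B (e x) (e y) = ⟪J x, y⟫_ℂ) {M N : Submodule ℂ K}
    (hMN : ∀ x, (∀ m ∈ M, B x m = 0) → ∀ n ∈ N, B x n = 0)
    (hM : ∀ m ∈ M, (B m m).re ≤ 0) {n : K} (hn : n ∈ N) : (B n n).re ≤ 0 := by
  let MX : Submodule ℂ X := M.comap e.toLinearMap
  have hmem : e.symm n ∈ MX.topologicalClosure := by
    rw [← Submodule.orthogonal_orthogonal_eq_closure, Submodule.mem_orthogonal]
    intro x hx
    rw [Submodule.mem_orthogonal'] at hx
    -- J turns Hilbert orthogonality into orthogonality for B, so the hypothesis says that N lies in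
    -- the double orthogonal complement of M, which is its closure.
    have h1 := hMN (e (J x)) (fun m hm => by
      have := hBJ (J x) (e.symm m)
      rw [e.apply_symm_apply, hJ] at this
      rw [this]
      exact hx _ (by simpa [MX] using hm)) n hn
    have h2 := hBJ (J x) (e.symm n)
    rwa [e.apply_symm_apply, hJ, h1, eq_comm] at h2
  have hcl : IsClosed {x : X | (B (e x) (e x)).re ≤ 0} := by
    simp only [hBJ]
    exact isClosed_le (Complex.continuous_re.comp (J.continuous.inner continuous_id))
      continuous_const
  have hsub : closure (MX : Set X) ⊆ {x : X | (B (e x) (e x)).re ≤ 0} :=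
    closure_minimal (fun x hx => hM _ hx) hcl
  simpa using hsub hmem

end Hilbert

/-! ### Definite decompositions and maximal uniformly positive subspaces -/

section Abstract

variable {K : Type u} [AddCommGroup K] [Module ℂ K] {B : K →ₗ⋆[ℂ] K →ₗ[ℂ] ℂ}

/-- An orthogonal decomposition of a Kreĭn space into a positive and a negative subspace is a
fundamental decomposition, and operators are bounded for it whenever they are bounded. -/
theorem isFundamentalDecomposition_of_definite (hB : B.IsSymm) {L N : Submodule ℂ K}
    (hLN : IsCompl L N) (horth : ∀ x ∈ L, ∀ y ∈ N, B x y = 0)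
    (hpos : ∀ x ∈ L, 0 ≤ (B x x).re) (hneg : ∀ x ∈ N, (B x x).re ≤ 0)
    {H : Type*} [NormedAddCommGroup H] [NormedSpace ℂ H] {T : K →ₗ[ℂ] H} (hT : IsBoundedOp B T) :
    IsFundamentalDecomposition B L N ∧
      ∃ C : ℝ, ∀ x ∈ L, ∀ y ∈ N, ‖T (x + y)‖ ≤ C * √((B x x).re - (B y y).re) := by
  obtain ⟨Kp, Km, hfd, C, hC⟩ := hT
  obtain ⟨X, _, _, _, e, J, hJ, hBJ, hnorm⟩ := hfd.exists_hilbert hB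
  obtain ⟨⟨M, hM, hle⟩, hLc, hNc⟩ := exists_norm_sq_le hB hJ hBJ hLN horth hpos hneg
  refine ⟨⟨hLN, horth, isHilbertOn_of_norm_sq_le hBJ hLc hM fun x hx => ?_,
    isHilbertOn_of_norm_sq_le (B := -B) (J := -J) (fun x y => by simp [hBJ]) hNc hM
      fun x hx => ?_⟩, |C| * √M, fun x hx y hy => ?_⟩
  · simpa using hle x hx 0 N.zero_mem
  · simpa using hle 0 L.zero_mem x hx
  · obtain ⟨p, hp, m, hm, hpm⟩ : ∃ p ∈ Kp, ∃ m ∈ Km, p + m = x + y := by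
      rw [← Submodule.mem_sup, hfd.isCompl.sup_eq_top]
      trivial
    have h1 := hC p hp m hm
    rw [← hnorm p hp m hm, hpm, Real.sqrt_sq (norm_nonneg _)] at h1
    rw [mul_assoc, ← Real.sqrt_mul hM.le]
    refine h1.trans (mul_le_mul (le_abs_self C) (Real.le_sqrt_of_sq_le (hle x hx y hy))
      (norm_nonneg _) (abs_nonneg C))

theorem IsKreinSpace.form_nonpos_of_dense (hK : IsKreinSpace B) {M N : Submodule ℂ K}
    (hMN : ∀ x, (∀ m ∈ M, B x m = 0) → ∀ n ∈ N, B x n = 0)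
    (hM : ∀ m ∈ M, (B m m).re ≤ 0) {n : K} (hn : n ∈ N) : (B n n).re ≤ 0 := by
  obtain ⟨hB, Kp, Km, hfd⟩ := hK
  obtain ⟨X, _, _, _, e, J, hJ, hBJ, -⟩ := hfd.exists_hilbert hB
  exact Krein.form_nonpos_of_dense hJ hBJ hMN hM hn

/-- If a positive M contains `Kp`, the `Km`-component of a vector of M again lies in M. There the
form would be both positive and negative unless the component vanishes. -/
theorem IsFundamentalDecomposition.maximal {Kp Km : Submodule ℂ K}
    (h : IsFundamentalDecomposition B Kp Km) : Maximal (IsUniformlyPositive B) Kp := by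
  refine ⟨⟨?_, h.hilbert_pos.pos⟩, fun M hM hle x hx => ?_⟩
  · refine top_unique (h.isCompl.sup_eq_top.symm.le.trans (sup_le_sup_left (fun y hy => ?_) Kp))
    rw [Submodule.mem_orthogonalBilin_iff]
    exact fun x hx => h.orthogonal x hx y hy
  · obtain ⟨p, hp, m, hm, rfl⟩ : ∃ p ∈ Kp, ∃ m ∈ Km, p + m = x := by
      rw [← Submodule.mem_sup, h.isCompl.sup_eq_top]
      trivial
    have hmM : m ∈ M := by simpa using M.sub_mem hx (hle hp)
    have : m = 0 := by
      by_contra hne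
      have h1 := hM.2 m hmM hne
      have h2 := h.hilbert_neg.pos m hm hne
      simp at h2
      linarith
    simpa [this] using hp

/-- The orthogonal companion of a maximal uniformly positive subspace is negative. -/
theorem form_nonpos_of_maximal (hB : B.IsSymm) {L : Submodule ℂ K}
    (hL : Maximal (IsUniformlyPositive B) L) {x : K} (hx : x ∈ L.orthogonalBilin B) :
    (B x x).re ≤ 0 := by
  by_contra! hpos
  rw [Submodule.mem_orthogonalBilin_iff] at hx
  have hx' : ∀ l ∈ L, B x l = 0 := fun l hl => by
    rw [← hB.eq, show B l x = 0 from hx l hl, map_zero]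
  have hBx : B x x ≠ 0 := fun h => by simp [h] at hpos
  have hmem : x ∈ L := by
    -- Adjoining a positive x ∈ L^⊥ keeps L regular and positive; maximality then puts x in L, so x
    -- is orthogonal to itself, a contradiction.
    refine hL.2 (y := L ⊔ Submodule.span ℂ {x}) ⟨?_, ?_⟩ le_sup_left
      (Submodule.mem_sup_right (Submodule.mem_span_singleton_self x))
    · refine top_unique fun k _ => ?_
      obtain ⟨l, hl, n, hn, rfl⟩ := Submodule.mem_sup.1
        (hL.1.1 ▸ Submodule.mem_top : k ∈ L ⊔ L.orthogonalBilin B)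
      rw [Submodule.mem_orthogonalBilin_iff] at hn
      -- The projection of n onto the line of x is moved to the first summand.
      rw [show l + n = (l + (B x n / B x x) • x) + (n - (B x n / B x x) • x) by abel]
      refine Submodule.add_mem_sup (Submodule.add_mem_sup hl
        (Submodule.smul_mem _ _ (Submodule.mem_span_singleton_self x))) ?_
      rw [Submodule.mem_orthogonalBilin_iff]
      intro y hy
      obtain ⟨l', hl', z, hz, rfl⟩ := Submodule.mem_sup.1 hy
      obtain ⟨c, rfl⟩ := Submodule.mem_span_singleton.1 hz
      have h1 : B l' n = 0 := hn l' hl'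
      have h2 : B l' x = 0 := hx l' hl'
      change B _ _ = 0
      simp [h1, h2]
      field_simp
      simp
    · intro y hy hy0
      obtain ⟨l', hl', z, hz, rfl⟩ := Submodule.mem_sup.1 hy
      obtain ⟨c, rfl⟩ := Submodule.mem_span_singleton.1 hz
      have h2 : B l' x = 0 := hx l' hl'
      have h3 : (B (l' + c • x) (l' + c • x)).re = (B l' l').re + ‖c‖ ^ 2 * (B x x).re := by
        simp [h2, hx' l' hl', ← mul_assoc, im_self_eq_zero hB, Complex.sq_norm,
          Complex.normSq_apply]
      rw [h3]
      by_cases hl0 : l' = 0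
      · have hc : c ≠ 0 := by rintro rfl; simp [hl0] at hy0
        subst hl0
        simp only [map_zero, Complex.zero_re, zero_add]
        positivity
      · have := hL.1.2 l' hl' hl0
        positivity
  exact hBx (hx x hmem)

end Abstract

end Krein

namespace Krein

universe u

/-! ### Factorisation of operators through ranges -/

section Factor

/-- A bounded operator whose range lies in the range of an injective bounded operator factors
through it. -/
theorem exists_comp_eq_of_injective {X Y Z : Type*} [NormedAddCommGroup X] [NormedSpace ℂ X]
    [CompleteSpace X] [NormedAddCommGroup Y] [NormedSpace ℂ Y] [CompleteSpace Y]
    [NormedAddCommGroup Z] [NormedSpace ℂ Z] (f : X →L[ℂ] Z) (g : Y →L[ℂ] Z)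
    (hg : Function.Injective g) (h : ∀ x, ∃ y, g y = f x) :
    ∃ S : X →L[ℂ] Y, ∀ x, g (S x) = f x := by
  choose s hs using h
  let S : X →ₗ[ℂ] Y :=
    { toFun := s
      map_add' := fun x y => hg (by simp [hs])
      map_smul' := fun c x => hg (by simp [hs]) }
  -- Closed graph theorem: both limits agree after applying the injective `g`.
  refine ⟨⟨S, S.continuous_of_seq_closed_graph fun v x y hv hy => hg ?_⟩, hs⟩
  have h1 : Tendsto (fun n => g (S (v n))) atTop (𝓝 (g y)) := (g.continuous.tendsto y).comp hy
  have h2 : Tendsto (fun n => g (S (v n))) atTop (𝓝 (f x)) :=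
    ((f.continuous.tendsto x).comp hv).congr fun n => (hs (v n)).symm
  exact (tendsto_nhds_unique h1 h2).trans (hs x).symm

/-- Douglas factorisation. Restricting `g` to the orthogonal complement of its kernel keeps the
range and makes it injective. -/
theorem exists_comp_eq {X Y Z : Type*} [NormedAddCommGroup X] [NormedSpace ℂ X]
    [CompleteSpace X] [NormedAddCommGroup Y] [InnerProductSpace ℂ Y] [CompleteSpace Y]
    [NormedAddCommGroup Z] [NormedSpace ℂ Z] (f : X →L[ℂ] Z) (g : Y →L[ℂ] Z)
    (h : ∀ x, ∃ y, g y = f x) : ∃ S : X →L[ℂ] Y, ∀ x, g (S x) = f x := by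
  let N : Submodule ℂ Y := LinearMap.ker g.toLinearMap
  have : CompleteSpace N := g.isClosed_ker.completeSpace_coe
  obtain ⟨S, hS⟩ := exists_comp_eq_of_injective f (g ∘L Nᗮ.subtypeL)
    ((injective_iff_map_eq_zero _).2 fun x hx => by
      have : (x : Y) ∈ N ⊓ Nᗮ := ⟨hx, x.2⟩
      rw [N.inf_orthogonal_eq_bot] at this
      exact Subtype.ext this)
    (fun x => by
      obtain ⟨y, hy⟩ := h x
      obtain ⟨a, ha, b, hb, rfl⟩ := N.exists_add_mem_mem_orthogonal y
      refine ⟨⟨b, hb⟩, ?_⟩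
      rw [map_add, show g a = 0 from ha, zero_add] at hy
      exact hy)
  exact ⟨Nᗮ.subtypeL ∘L S, hS⟩

/-- A Hilbert space continuously embedded in `H` by `S` is determined by `S S†`. -/
theorem exists_eq_of_comp_adjoint_eq {H F F' : Type*} [NormedAddCommGroup H]
    [InnerProductSpace ℂ H] [CompleteSpace H] [NormedAddCommGroup F] [InnerProductSpace ℂ F]
    [CompleteSpace F] [NormedAddCommGroup F'] [InnerProductSpace ℂ F'] [CompleteSpace F']
    {S : F →L[ℂ] H} {S' : F' →L[ℂ] H} (hS : Function.Injective S)
    (h : ∀ w, S (S.adjoint w) = S' (S'.adjoint w)) (y : F) : ∃ y', S' y' = S y ∧ ‖y'‖ = ‖y‖ := by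
  have hdense : Dense (LinearMap.range S.adjoint.toLinearMap : Set F) := by
    rw [Submodule.dense_iff_topologicalClosure_eq_top, Submodule.topologicalClosure_eq_top_iff]
    refine (Submodule.eq_bot_iff _).2 fun x hx => hS ?_
    rw [map_zero, ← inner_self_eq_zero (𝕜 := ℂ), ← ContinuousLinearMap.adjoint_inner_left]
    exact (Submodule.mem_orthogonal _ _).1 hx _ ⟨S x, rfl⟩
  -- Both squared norms equal ⟪S S† w, w⟫. Hence S† w ↦ S'† w is isometric on a dense subspace and
  -- extends by Cauchy sequences.
  have hnorm : ∀ w, ‖S'.adjoint w‖ = ‖S.adjoint w‖ := fun w => by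
    have : ⟪S'.adjoint w, S'.adjoint w⟫_ℂ = ⟪S.adjoint w, S.adjoint w⟫_ℂ := by
      rw [ContinuousLinearMap.adjoint_inner_left, ContinuousLinearMap.adjoint_inner_left, h]
    rw [inner_self_eq_norm_sq_to_K, inner_self_eq_norm_sq_to_K] at this
    norm_cast at this
    exact (sq_eq_sq₀ (norm_nonneg _) (norm_nonneg _)).1 this
  obtain ⟨v, hv, hvy⟩ := mem_closure_iff_seq_limit.1 (hdense y)
  choose w hw using hv
  have hw' : ∀ n, S.adjoint (w n) = v n := hw
  have hcau : CauchySeq fun n => S'.adjoint (w n) := Metric.cauchySeq_iff.2 fun ε hε => by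
    obtain ⟨N, hN⟩ := Metric.cauchySeq_iff.1 hvy.cauchySeq ε hε
    refine ⟨N, fun m hm n hn => ?_⟩
    have := hN m hm n hn
    rwa [dist_eq_norm, ← map_sub, hnorm, map_sub, hw', hw', ← dist_eq_norm]
  obtain ⟨y', hy'⟩ := cauchySeq_tendsto_of_complete hcau
  refine ⟨y', tendsto_nhds_unique ((S'.continuous.tendsto y').comp hy') ?_,
    tendsto_nhds_unique hy'.norm ?_⟩
  · refine ((S.continuous.tendsto y).comp hvy).congr fun n => ?_
    simp [← h, hw']
  · refine hvy.norm.congr fun n => ?_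
    rw [hnorm, hw']

end Factor

/-! ### Equality and sign reversal of embedded Kreĭn spaces -/

/-- Polarisation: x + y and x + i y yield the sum and the difference of B x y and B y x. -/
theorem form_eq_of_diagonal {K : Type*} [AddCommGroup K] [Module ℂ K]
    {B B' : K →ₗ⋆[ℂ] K →ₗ[ℂ] ℂ} (h : ∀ x, B x x = B' x x) : B = B' := by
  ext x y
  have h1 := h (x + y)
  have h2 := h (x + Complex.I • y)
  simp only [map_add, map_smulₛₗ, LinearMap.add_apply, LinearMap.smul_apply, h,
    Complex.conj_I, smul_eq_mul] at h1 h2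
  have h3 : Complex.I ≠ 0 := Complex.I_ne_zero
  have h4 : B x y + B y x = B' x y + B' y x := by linear_combination h1
  have h5 : Complex.I * (B x y - B y x) = Complex.I * (B' x y - B' y x) := by
    linear_combination h2
  linear_combination (h4 + mul_left_cancel₀ h3 h5) / 2

theorem IsFundamentalDecomposition.neg {K : Type*} [AddCommGroup K] [Module ℂ K]
    {B : K →ₗ⋆[ℂ] K →ₗ[ℂ] ℂ} (hB : B.IsSymm) {Kp Km : Submodule ℂ K}
    (h : IsFundamentalDecomposition B Kp Km) : IsFundamentalDecomposition (-B) Km Kp where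
  isCompl := h.isCompl.symm
  orthogonal x hx y hy := by simp [← hB.eq y x, h.orthogonal y hy x hx]
  hilbert_pos := h.hilbert_neg
  hilbert_neg := by simpa using h.hilbert_pos

theorem isUniformlyPositive_neg {K : Type*} [AddCommGroup K] [Module ℂ K]
    (B : K →ₗ⋆[ℂ] K →ₗ[ℂ] ℂ) : IsUniformlyPositive (-B) = IsUniformlyNegative B := by
  ext L
  have : L.orthogonalBilin (-B) = L.orthogonalBilin B := by
    ext x
    simp [Submodule.mem_orthogonalBilin_iff]
  simp [IsUniformlyPositive, IsUniformlyNegative, IsRegular, this]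

variable {H : Type u} [NormedAddCommGroup H] [InnerProductSpace ℂ H]

namespace EmbeddedKreinSpace

theorem ext_of_diagonal {𝒦 𝒦' : EmbeddedKreinSpace H} (hc : 𝒦.carrier ≤ 𝒦'.carrier)
    (hc' : 𝒦'.carrier ≤ 𝒦.carrier)
    (hf : ∀ x : 𝒦.carrier, 𝒦'.form ⟨x, hc x.2⟩ ⟨x, hc x.2⟩ = 𝒦.form x x) : 𝒦 = 𝒦' := by
  obtain ⟨V, B, h1, h2⟩ := 𝒦
  obtain ⟨V', B', h1', h2'⟩ := 𝒦'
  obtain rfl : V = V' := le_antisymm hc hc'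
  obtain rfl : B = B' := form_eq_of_diagonal fun x => (hf x).symm
  rfl

/-- The Kreĭn space with the opposite form. -/
def neg (𝒦 : EmbeddedKreinSpace H) : EmbeddedKreinSpace H where
  carrier := 𝒦.carrier
  form := -𝒦.form
  isKrein := by
    obtain ⟨hs, Kp, Km, h⟩ := 𝒦.isKrein
    exact ⟨isSymm_neg hs, Km, Kp, h.neg hs⟩
  bounded := by
    obtain ⟨Kp, Km, h, C, hC⟩ := 𝒦.bounded
    refine ⟨Km, Kp, h.neg 𝒦.isKrein.1, C, fun x hx y hy => ?_⟩
    rw [add_comm]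
    refine (hC y hy x hx).trans_eq ?_
    congr 2
    simp
    ring

theorem neg_neg (𝒦 : EmbeddedKreinSpace H) : 𝒦.neg.neg = 𝒦 :=
  ext_of_diagonal le_rfl le_rfl fun x => by
    simp only [neg, _root_.neg_neg]
    rfl

theorem ιSharp_eq_of_forall {𝒦 : EmbeddedKreinSpace H} {w : H} {k : 𝒦.carrier}
    (h : ∀ x : 𝒦.carrier, ⟪(x : H), w⟫_ℂ = 𝒦.form x k) : 𝒦.ιSharp w = k :=
  sub_eq_zero.1 (𝒦.isKrein.nondegenerate fun x => by
    rw [map_sub, ← 𝒦.ιSharp_spec, ← h, sub_eq_zero]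
    rfl)

theorem neg_ιSharp (𝒦 : EmbeddedKreinSpace H) (w : H) :
    𝒦.neg.ιSharp w = (-𝒦.ιSharp w : 𝒦.carrier) :=
  ιSharp_eq_of_forall fun x => by
    refine (𝒦.ιSharp_spec x w).trans ?_
    change _ = -(𝒦.form x (-𝒦.ιSharp w))
    rw [map_neg, _root_.neg_neg]

theorem isAssociated_iff {𝒦 : EmbeddedKreinSpace H} {A : H →L[ℂ] H} :
    𝒦.IsAssociated A ↔ ∀ w, (𝒦.ιSharp w : H) = A w :=
  LinearMap.ext_iff

theorem IsAssociated.neg {𝒦 : EmbeddedKreinSpace H} {A : H →L[ℂ] H} (h : 𝒦.IsAssociated A) :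
    𝒦.neg.IsAssociated (-A) := by
  rw [isAssociated_iff] at h ⊢
  intro w
  rw [neg_ιSharp, neg_apply, ← h]
  rfl

theorem range_neg_ιSharp (𝒦 : EmbeddedKreinSpace H) :
    LinearMap.range 𝒦.neg.ιSharp = (LinearMap.range 𝒦.ιSharp : Submodule ℂ 𝒦.carrier) := by
  ext x
  constructor
  · rintro ⟨w, rfl⟩
    exact ⟨-w, by rw [map_neg, neg_ιSharp]⟩
  · rintro ⟨w, rfl⟩
    exact ⟨-w, by rw [map_neg, neg_ιSharp]; exact _root_.neg_neg _⟩

theorem form_ιSharp (𝒦 : EmbeddedKreinSpace H) (w : H) (k : 𝒦.carrier) :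
    𝒦.form (𝒦.ιSharp w) k = ⟪w, (k : H)⟫_ℂ := by
  rw [← 𝒦.isKrein.1.eq, ← 𝒦.ιSharp_spec, inner_conj_symm]
  rfl

/-! ### Embedded Kreĭn spaces as pairs of operators -/

section Model

variable [CompleteSpace H] {E F F' : Type*} [NormedAddCommGroup E] [InnerProductSpace ℂ E]
  [CompleteSpace E] [NormedAddCommGroup F] [InnerProductSpace ℂ F] [CompleteSpace F]
  [NormedAddCommGroup F'] [InnerProductSpace ℂ F'] [CompleteSpace F']

/-- The minus sign compensates the negative form on the range of `g`; it is the source of ι ι^♯ = T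
T† - S S†. -/
theorem ιSharp_of_isModel {𝒦 : EmbeddedKreinSpace H} {f : E →ₗ[ℂ] 𝒦.carrier}
    {g : F →ₗ[ℂ] 𝒦.carrier} (hm : IsModel 𝒦.form f g) {T : E →L[ℂ] H} {S : F →L[ℂ] H}
    (hT : ∀ x, (f x : H) = T x) (hS : ∀ y, (g y : H) = S y) (w : H) :
    𝒦.ιSharp w = f (T.adjoint w) - g (S.adjoint w) :=
  ιSharp_eq_of_forall fun k => by
    obtain ⟨x, y, rfl⟩ := hm.exists_add k
    rw [sub_eq_add_neg, ← map_neg, hm.form_apply 𝒦.isKrein.1, Submodule.coe_add, hT, hS,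
      inner_add_left, inner_neg_right, ContinuousLinearMap.adjoint_inner_right,
      ContinuousLinearMap.adjoint_inner_right, sub_neg_eq_add]

theorem isAssociated_iff_of_isModel {𝒦 : EmbeddedKreinSpace H} {f : E →ₗ[ℂ] 𝒦.carrier}
    {g : F →ₗ[ℂ] 𝒦.carrier} (hm : IsModel 𝒦.form f g) {T : E →L[ℂ] H} {S : F →L[ℂ] H}
    (hT : ∀ x, (f x : H) = T x) (hS : ∀ y, (g y : H) = S y) {A : H →L[ℂ] H} :
    𝒦.IsAssociated A ↔ ∀ w, T (T.adjoint w) - S (S.adjoint w) = A w := by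
  rw [isAssociated_iff]
  simp only [ιSharp_of_isModel hm hT hS, Submodule.coe_sub, hT, hS]

omit [CompleteSpace E] in
-- The positive parts share T, so only the negative components need matching, and S S† = S' S'†
-- matches them with equal norms.
theorem le_and_form_eq_of_isModel {𝒦 𝒦' : EmbeddedKreinSpace H} {f : E →ₗ[ℂ] 𝒦.carrier}
    {g : F →ₗ[ℂ] 𝒦.carrier} (hm : IsModel 𝒦.form f g) {f' : E →ₗ[ℂ] 𝒦'.carrier}
    {g' : F' →ₗ[ℂ] 𝒦'.carrier} (hm' : IsModel 𝒦'.form f' g') {T : E →L[ℂ] H} {S : F →L[ℂ] H}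
    {S' : F' →L[ℂ] H} (hT : ∀ x, (f x : H) = T x) (hS : ∀ y, (g y : H) = S y)
    (hT' : ∀ x, (f' x : H) = T x) (hS' : ∀ y, (g' y : H) = S' y)
    (h : ∀ w, S (S.adjoint w) = S' (S'.adjoint w)) (k : 𝒦.carrier) :
    ∃ hk : (k : H) ∈ 𝒦'.carrier, 𝒦'.form ⟨k, hk⟩ ⟨k, hk⟩ = 𝒦.form k k := by
  have hinj : Function.Injective S := fun y z hyz => by
    rw [← hS, ← hS] at hyz
    exact injective_of_form_eq_inner hm.neg (Subtype.ext hyz)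
  obtain ⟨x, y, rfl⟩ := hm.exists_add k
  obtain ⟨y', hy', hn⟩ := exists_eq_of_comp_adjoint_eq hinj h y
  have hk : ((f x + g y : 𝒦.carrier) : H) = (f' x + g' y' : 𝒦'.carrier) := by
    simp [hT, hS, hT', hS', hy']
  refine ⟨hk ▸ Subtype.property _, ?_⟩
  have : ∀ h, (⟨((f x + g y : 𝒦.carrier) : H), h⟩ : 𝒦'.carrier) = f' x + g' y' :=
    fun h => Subtype.ext hk
  rw [this, hm.form_apply 𝒦.isKrein.1, hm'.form_apply 𝒦'.isKrein.1]
  simp only [inner_self_eq_norm_sq_to_K, hn]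

omit [CompleteSpace E] in
theorem eq_of_isModel {𝒦 𝒦' : EmbeddedKreinSpace H} {f : E →ₗ[ℂ] 𝒦.carrier}
    {g : F →ₗ[ℂ] 𝒦.carrier} (hm : IsModel 𝒦.form f g) {f' : E →ₗ[ℂ] 𝒦'.carrier}
    {g' : F' →ₗ[ℂ] 𝒦'.carrier} (hm' : IsModel 𝒦'.form f' g') {T : E →L[ℂ] H} {S : F →L[ℂ] H}
    {S' : F' →L[ℂ] H} (hT : ∀ x, (f x : H) = T x) (hS : ∀ y, (g y : H) = S y)
    (hT' : ∀ x, (f' x : H) = T x) (hS' : ∀ y, (g' y : H) = S' y)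
    (h : ∀ w, S (S.adjoint w) = S' (S'.adjoint w)) : 𝒦 = 𝒦' :=
  ext_of_diagonal
    (fun k hk => (le_and_form_eq_of_isModel hm hm' hT hS hT' hS' h ⟨k, hk⟩).1)
    (fun k hk => (le_and_form_eq_of_isModel hm' hm hT' hS' hT hS (fun w => (h w).symm) ⟨k, hk⟩).1)
    fun k => (le_and_form_eq_of_isModel hm hm' hT hS hT' hS' h k).2

omit [CompleteSpace H] in
/-- Two jointly injective bounded operators define a continuously embedded Kreĭn space. -/
theorem exists_isModel (T : E →L[ℂ] H) (S : F →L[ℂ] H)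
    (hinj : Function.Injective (T.coprod S)) :
    ∃ (𝒦 : EmbeddedKreinSpace H) (f : E →ₗ[ℂ] 𝒦.carrier) (g : F →ₗ[ℂ] 𝒦.carrier),
      IsModel 𝒦.form f g ∧ (∀ x, (f x : H) = T x) ∧ ∀ y, (g y : H) = S y := by
  let Φ : E × F →ₗ[ℂ] H := (T.coprod S).toLinearMap
  let e : (E × F) ≃ₗ[ℂ] LinearMap.range Φ := LinearEquiv.ofInjective Φ hinj
  let p : LinearMap.range Φ →ₗ[ℂ] E := LinearMap.fst ℂ E F ∘ₗ e.symm.toLinearMap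
  let q : LinearMap.range Φ →ₗ[ℂ] F := LinearMap.snd ℂ E F ∘ₗ e.symm.toLinearMap
  let B : LinearMap.range Φ →ₗ⋆[ℂ] LinearMap.range Φ →ₗ[ℂ] ℂ :=
    LinearMap.mk₂'ₛₗ (starRingEnd ℂ) (RingHom.id ℂ) (fun k l => ⟪p k, p l⟫_ℂ - ⟪q k, q l⟫_ℂ)
      (fun k k' l => by simp only [map_add, inner_add_left]; ring)
      (fun c k l => by
        simp only [map_smul, inner_smul_left, smul_eq_mul]; ring)
      (fun k l l' => by simp only [map_add, inner_add_right]; ring)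
      (fun c k l => by
        simp only [map_smul, inner_smul_right, smul_eq_mul, RingHom.id_apply]; ring)
  have hBdef : ∀ k l, B k l = ⟪p k, p l⟫_ℂ - ⟪q k, q l⟫_ℂ := fun k l => rfl
  have hB : B.IsSymm := ⟨fun k l => by simp [hBdef]⟩
  let f : E →ₗ[ℂ] LinearMap.range Φ := e.toLinearMap ∘ₗ LinearMap.inl ℂ E F
  let g : F →ₗ[ℂ] LinearMap.range Φ := e.toLinearMap ∘ₗ LinearMap.inr ℂ E F
  have hpf : ∀ x, p (f x) = x := fun x => by simp [p, f]
  have hqf : ∀ x, q (f x) = 0 := fun x => by simp [q, f]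
  have hpg : ∀ x, p (g x) = 0 := fun x => by simp [p, g]
  have hqg : ∀ x, q (g x) = x := fun x => by simp [q, g]
  have hm : IsModel B f g :=
    { sup_eq_top := by
        refine top_unique fun k _ => ?_
        obtain ⟨⟨x, y⟩, rfl⟩ := e.surjective k
        refine Submodule.mem_sup.2 ⟨f x, ⟨x, rfl⟩, g y, ⟨y, rfl⟩, ?_⟩
        simp [f, g, ← map_add]
      pos := fun x y => by simp [hBdef, hpf, hqf]
      neg := fun x y => by simp [hBdef, hpg, hqg]
      orthogonal := fun x y => by simp [hBdef, hpf, hpg, hqf] }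
  have hT : ∀ x, (f x : H) = T x := fun x => by
    change T x + S 0 = T x
    simp
  have hS : ∀ y, (g y : H) = S y := fun y => by
    change T 0 + S y = S y
    simp
  refine ⟨⟨LinearMap.range Φ, B, ⟨hB, _, _, hm.isFundamentalDecomposition⟩,
    _, _, hm.isFundamentalDecomposition, ‖T‖ + ‖S‖, ?_⟩, f, g, hm, hT, hS⟩
  rintro _ ⟨x, rfl⟩ _ ⟨y, rfl⟩
  have h1 := re_form_eq_norm_sq hm.pos x
  have h2 := re_form_eq_norm_sq hm.neg y
  simp only [LinearMap.neg_apply, Complex.neg_re] at h2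
  rw [h1, sub_eq_add_neg, h2, Submodule.subtype_apply, Submodule.coe_add, hT, hS, add_mul]
  refine (norm_add_le _ _).trans (add_le_add ?_ ?_)
  · refine (T.le_opNorm x).trans ?_
    gcongr
    exact Real.le_sqrt_of_sq_le (by nlinarith [sq_nonneg ‖y‖])
  · refine (S.le_opNorm y).trans ?_
    gcongr
    exact Real.le_sqrt_of_sq_le (by nlinarith [sq_nonneg ‖x‖])

end Model

/-! ### Uniqueness from a maximal uniformly positive subspace -/

variable [CompleteSpace H]

/-- The space is determined by the operator when the range of the adjoint of its embedding contains a
maximal uniformly positive subspace. -/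
theorem eq_of_maximal_le_range {𝒦 𝒦' : EmbeddedKreinSpace H} {A : H →L[ℂ] H}
    (h : 𝒦.IsAssociated A) (h' : 𝒦'.IsAssociated A) {L : Submodule ℂ 𝒦.carrier}
    (hL : Maximal (IsUniformlyPositive 𝒦.form) L) (hLr : L ≤ LinearMap.range 𝒦.ιSharp) :
    𝒦 = 𝒦' := by
  have hA := isAssociated_iff.1 h
  have hA' := isAssociated_iff.1 h'
  have hB := 𝒦.isKrein.1
  have hB' := 𝒦'.isKrein.1
  have horth : ∀ x ∈ L, ∀ y ∈ L.orthogonalBilin 𝒦.form, 𝒦.form x y = 0 := fun x hx y hy => hy x hx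
  have hpos : ∀ x ∈ L, 0 ≤ (𝒦.form x x).re := fun x hx => by
    by_cases hx0 : x = 0
    · simp [hx0]
    · exact (hL.1.2 x hx hx0).le
  have hcompl : IsCompl L (L.orthogonalBilin 𝒦.form) := by
    refine ⟨Submodule.disjoint_def.2 fun x hx hx' => ?_, codisjoint_iff.2 hL.1.1⟩
    by_contra hne
    have := hL.1.2 x hx hne
    simp [horth x hx x hx'] at this
  obtain ⟨hfd, C, hC⟩ := isFundamentalDecomposition_of_definite hB hcompl horth hpos
    (fun x hx => form_nonpos_of_maximal hB hL hx) 𝒦.bounded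
  obtain ⟨E, _, _, _, f, hf, hfL⟩ := hfd.hilbert_pos.exists_realization hB
  obtain ⟨F, _, _, _, g, hg, hgN⟩ := hfd.hilbert_neg.exists_realization (isSymm_neg hB)
  have hfm : ∀ x, f x ∈ L := fun x => hfL ▸ ⟨x, rfl⟩
  have hgm : ∀ x, g x ∈ L.orthogonalBilin 𝒦.form := fun x => hgN ▸ ⟨x, rfl⟩
  have hm : IsModel 𝒦.form f g :=
    ⟨by rw [hfL, hgN]; exact hL.1.1, hf, hg, fun x y => horth _ (hfm x) _ (hgm y)⟩
  let T : E →L[ℂ] H := (𝒦.carrier.subtype ∘ₗ f).mkContinuous C fun x => by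
    have := hC (f x) (hfm x) 0 (Submodule.zero_mem _)
    simpa [norm_eq_sqrt_form hf x] using this
  let S : F →L[ℂ] H := (𝒦.carrier.subtype ∘ₗ g).mkContinuous C fun x => by
    have := hC 0 (Submodule.zero_mem _) (g x) (hgm x)
    simpa [norm_eq_sqrt_form hg x] using this
  have hT : ∀ x, (f x : H) = T x := fun x => rfl
  have hS : ∀ x, (g x : H) = S x := fun x => rfl
  -- A R = T: the inclusion of L in ran ι^♯ becomes a bounded factorisation that no longer mentions
  -- 𝒦 and can be used in 𝒦'.
  obtain ⟨R, hR⟩ := exists_comp_eq T A fun x => by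
    obtain ⟨w, hw⟩ := hLr (hfm x)
    exact ⟨w, by rw [← hA, hw, hT]⟩
  have hfR : ∀ x, 𝒦.ιSharp (R x) = f x := fun x => Subtype.ext (by rw [hA, hR, hT])
  let f' : E →ₗ[ℂ] 𝒦'.carrier := 𝒦'.ιSharp ∘ₗ R.toLinearMap
  have hfR' : ∀ x, 𝒦'.ιSharp (R x) = f' x := fun x => rfl
  have hT' : ∀ x, (f' x : H) = T x := fun x => by rw [← hfR', hA', hR]
  have hf' : ∀ x y, 𝒦'.form (f' x) (f' y) = ⟪x, y⟫_ℂ := fun x y => by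
    rw [← hf, ← hfR', ← hfR, form_ιSharp, form_ιSharp, hT, hT']
  set L' := LinearMap.range f'
  set N' := L'.orthogonalBilin 𝒦'.form
  have horth' : ∀ x ∈ L', ∀ y ∈ N', 𝒦'.form x y = 0 := fun x hx y hy => hy x hx
  -- f' R† is the orthogonal projection onto L', because the form of f' x with k is ⟪R x, k⟫ = ⟪x,
  -- R† k⟫.
  have hmemN' : ∀ k : 𝒦'.carrier, k - f' (R.adjoint k) ∈ N' := fun k => by
    rintro _ ⟨x, rfl⟩
    change 𝒦'.form _ _ = 0
    rw [map_sub, hf', ← hfR', form_ιSharp,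
      ContinuousLinearMap.adjoint_inner_right, sub_self]
  have hsup' : L' ⊔ N' = ⊤ := top_unique fun k _ =>
    Submodule.mem_sup.2 ⟨_, ⟨R.adjoint k, rfl⟩, _, hmemN' k, add_sub_cancel _ _⟩
  have hcompl' : IsCompl L' N' := by
    refine ⟨Submodule.disjoint_def.2 ?_, codisjoint_iff.2 hsup'⟩
    rintro _ ⟨x, rfl⟩ hx
    have := horth' _ ⟨x, rfl⟩ _ hx
    rw [hf', inner_self_eq_zero] at this
    rw [this, map_zero]
  have hneg' : ∀ x ∈ N', (𝒦'.form x x).re ≤ 0 := fun x hx => by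
    -- Only vectors ι'^♯ w can be compared with 𝒦. They are dense enough: a vector orthogonal to
    -- this M has an N'-component orthogonal to all of ran ι'^♯, hence zero.
    refine 𝒦'.isKrein.form_nonpos_of_dense (M := N' ⊓ LinearMap.range 𝒦'.ιSharp) (N := N')
      ?_ ?_ hx
    · intro x hx n hn
      suffices x - f' (R.adjoint x) = 0 by
        rw [sub_eq_zero.1 this]
        exact horth' _ ⟨_, rfl⟩ _ hn
      have hzero : ∀ w, 𝒦'.form (𝒦'.ιSharp w) (x - f' (R.adjoint x)) = 0 := fun w => by
        have h1 := hmemN' (𝒦'.ιSharp w)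
        have h2 := hx (𝒦'.ιSharp w - f' (R.adjoint (𝒦'.ιSharp w)))
          ⟨h1, w - R (R.adjoint (𝒦'.ιSharp w)), by rw [map_sub, hfR']⟩
        have h3 := horth' _ ⟨R.adjoint x, rfl⟩ _ h1
        have h4 := horth' _ ⟨R.adjoint (𝒦'.ιSharp w), rfl⟩ _ (hmemN' x)
        rw [← sub_add_cancel (𝒦'.ιSharp w) (f' (R.adjoint (𝒦'.ιSharp w))), map_add,
          LinearMap.add_apply, h4, add_zero, ← hB'.eq, map_sub 𝒦'.form, LinearMap.sub_apply, h2, h3,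
          sub_zero, map_zero]
      refine Subtype.ext (inner_self_eq_zero (𝕜 := ℂ).1 ?_)
      rw [← form_ιSharp]
      exact hzero _
    · rintro _ ⟨hm1, w, rfl⟩
      -- L and L' have the same image in `H`, so ι'^♯ w ⊥ L' and ι^♯ w ⊥ L are the same condition on
      -- w.
      have h1 : 𝒦.ιSharp w ∈ L.orthogonalBilin 𝒦.form := by
        rw [← hfL, Submodule.mem_orthogonalBilin_iff]
        rintro _ ⟨x, rfl⟩
        have := horth' (f' x) ⟨x, rfl⟩ _ hm1
        rw [← 𝒦'.ιSharp_spec] at this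
        change 𝒦.form _ _ = 0
        rw [← 𝒦.ιSharp_spec]
        change ⟪(f x : H), w⟫_ℂ = 0
        rw [hT, ← hT']
        exact this
      have h2 := form_nonpos_of_maximal hB hL h1
      rw [form_ιSharp, hA] at h2
      rwa [form_ιSharp, hA']
  obtain ⟨hfd', C', hC'⟩ := isFundamentalDecomposition_of_definite hB' hcompl' horth'
    (by rintro _ ⟨x, rfl⟩; rw [re_form_eq_norm_sq hf']; positivity) hneg' 𝒦'.bounded
  obtain ⟨F', _, _, _, g', hg', hgN'⟩ := hfd'.hilbert_neg.exists_realization (isSymm_neg hB')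
  have hgm' : ∀ x, g' x ∈ N' := fun x => hgN' ▸ ⟨x, rfl⟩
  have hm' : IsModel 𝒦'.form f' g' :=
    ⟨by rw [hgN']; exact hsup', hf', hg', fun x y => horth' _ ⟨x, rfl⟩ _ (hgm' y)⟩
  let S' : F' →L[ℂ] H := (𝒦'.carrier.subtype ∘ₗ g').mkContinuous C' fun x => by
    have := hC' 0 (Submodule.zero_mem _) (g' x) (hgm' x)
    simpa [norm_eq_sqrt_form hg' x] using this
  have hS' : ∀ x, (g' x : H) = S' x := fun x => rfl
  refine eq_of_isModel hm hm' hT hS hT' hS' fun w => ?_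
  have h1 := (isAssociated_iff_of_isModel hm hT hS).1 h w
  have h2 := (isAssociated_iff_of_isModel hm' hT' hS').1 h' w
  exact sub_right_injective (h1.trans h2.symm)

end EmbeddedKreinSpace

end Krein

namespace Krein

/-! ### Hyperbolic rotations preserving T T† - S S† -/

section Boost

variable {H E F : Type*} [NormedAddCommGroup H] [InnerProductSpace ℂ H] [CompleteSpace H]
  [NormedAddCommGroup E] [InnerProductSpace ℂ E] [CompleteSpace E]
  [NormedAddCommGroup F] [InnerProductSpace ℂ F] [CompleteSpace F]

/-- The perturbation moves the image of the unit vector e from T e to T e + a and leaves T unchanged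
on the orthogonal complement of e: one half of an elementary rotation. -/
theorem comp_adjoint_add_rankOne (T : F →L[ℂ] H) {e : F} (he : ‖e‖ = 1)
    (a w : H) :
    ((T + InnerProductSpace.rankOne ℂ a e) ∘L (T + InnerProductSpace.rankOne ℂ a e).adjoint) w
      = T (T.adjoint w) + ⟪a, w⟫_ℂ • T e + ⟪T e, w⟫_ℂ • a + ⟪a, w⟫_ℂ • a := by
  have h1 : ⟪e, T.adjoint w⟫_ℂ = ⟪T e, w⟫_ℂ := ContinuousLinearMap.adjoint_inner_right _ _ _
  have h2 : ⟪e, e⟫_ℂ = 1 := by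
    rw [inner_self_eq_norm_sq_to_K, he]
    simp
  rw [map_add, InnerProductSpace.adjoint_rankOne, ContinuousLinearMap.comp_apply, add_apply,
    add_apply, InnerProductSpace.rankOne_apply, InnerProductSpace.rankOne_apply, map_add, map_smul,
    inner_add_right, inner_smul_right, h1, h2, mul_one, add_smul]
  abel

/-- A hyperbolic rotation in the plane spanned by `e` and `f` does not change `T T† - S S†`. -/
theorem comp_adjoint_sub_of_boost (T : E →L[ℂ] H) (S : F →L[ℂ] H) {e : E} {f : F}
    (he : ‖e‖ = 1) (hf : ‖f‖ = 1) {c s : ℝ} (hcs : c ^ 2 - s ^ 2 = 1) :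
    (T + InnerProductSpace.rankOne ℂ (((c - 1 : ℝ) : ℂ) • T e + (s : ℂ) • S f) e) ∘L
        (T + InnerProductSpace.rankOne ℂ (((c - 1 : ℝ) : ℂ) • T e + (s : ℂ) • S f) e).adjoint -
      (S + InnerProductSpace.rankOne ℂ ((s : ℂ) • T e + ((c - 1 : ℝ) : ℂ) • S f) f) ∘L
        (S + InnerProductSpace.rankOne ℂ ((s : ℂ) • T e + ((c - 1 : ℝ) : ℂ) • S f) f).adjoint
      = T ∘L T.adjoint - S ∘L S.adjoint := by
  have hcs' : (c : ℂ) ^ 2 - (s : ℂ) ^ 2 = 1 := by exact_mod_cast hcs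
  ext w
  rw [sub_apply, sub_apply, comp_adjoint_add_rankOne T he, comp_adjoint_add_rankOne S hf]
  simp only [ContinuousLinearMap.comp_apply, inner_add_left, inner_smul_left, Complex.conj_ofReal]
  push_cast
  match_scalars
  · ring
  · linear_combination (⟪T e, w⟫_ℂ) * hcs'
  · linear_combination (-⟪S f, w⟫_ℂ) * hcs'
  · ring

/-- If `ran T†` and `ran S†` contain suitable orthonormal sequences, then `T T† - S S†` can be
written in a similar way with a different sum of ranges. -/
theorem exists_range_ne_of_orthonormal {T : E →L[ℂ] H} {S : F →L[ℂ] H}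
    (hinj : Function.Injective (T.coprod S)) {y z : ℕ → H}
    (hy : Orthonormal ℂ fun n => T.adjoint (y n)) (hz : Orthonormal ℂ fun n => S.adjoint (z n))
    (hSy : ∀ n, S.adjoint (y n) = 0) (hTz : ∀ n, T.adjoint (z n) = 0)
    (hTy : ∀ n, ‖T (T.adjoint (y n))‖ ≤ Real.exp (-(2 * n)))
    (hSz : ∀ n, ‖S (S.adjoint (z n))‖ ≤ Real.exp (-(2 * n))) :
    ∃ (T' : E →L[ℂ] H) (S' : F →L[ℂ] H), Function.Injective (T'.coprod S') ∧
      T' ∘L T'.adjoint - S' ∘L S'.adjoint = T ∘L T.adjoint - S ∘L S.adjoint ∧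
      ¬ ∀ p, ∃ p', T'.coprod S' p' = T.coprod S p := by
  set e := fun n => T.adjoint (y n)
  set f := fun n => S.adjoint (z n)
  -- The angle n is unbounded, yet cosh n + sinh n = exp n against the bound exp (-2n) leaves the
  -- summable exp (-n).
  let c : ℕ → ℝ := fun n => Real.cosh n
  let s : ℕ → ℝ := fun n => Real.sinh n
  have hcs : ∀ n, c n ^ 2 - s n ^ 2 = 1 := fun n => Real.cosh_sq_sub_sinh_sq _
  have hcs' : ∀ n, (c n : ℂ) ^ 2 - (s n : ℂ) ^ 2 = 1 := fun n => by exact_mod_cast hcs n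
  have hc1 : ∀ n, 1 ≤ c n := fun n => Real.one_le_cosh _
  have hs0 : ∀ n, 0 ≤ s n := fun n => Real.sinh_nonneg_iff.2 n.cast_nonneg
  have hcsum : ∀ n, c n + s n = Real.exp n := fun n => Real.cosh_add_sinh _
  let a : ℕ → H := fun n => ((c n - 1 : ℝ) : ℂ) • T (e n) + (s n : ℂ) • S (f n)
  let b : ℕ → H := fun n => (s n : ℂ) • T (e n) + ((c n - 1 : ℝ) : ℂ) • S (f n)
  have hbound : ∀ (n : ℕ) (p q : H), ‖p‖ ≤ Real.exp (-(2 * n)) → ‖q‖ ≤ Real.exp (-(2 * n)) →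
      ‖((c n - 1 : ℝ) : ℂ) • p + (s n : ℂ) • q‖ ≤ Real.exp (-n) := fun n p q hp hq => by
    have h1 := hc1 n
    have h2 := hs0 n
    have h3 := hcsum n
    refine (norm_add_le _ _).trans ?_
    rw [norm_smul, norm_smul, Complex.norm_of_nonneg (by linarith), Complex.norm_of_nonneg h2,
      show -(n : ℝ) = n + -(2 * n) by ring, Real.exp_add, ← h3]
    have h4 := Real.exp_pos (-(2 * (n : ℝ)))
    nlinarith [mul_le_mul_of_nonneg_left hp (by linarith : 0 ≤ c n - 1),
      mul_le_mul_of_nonneg_left hq h2]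
  have ha : ∀ n, ‖a n‖ ≤ Real.exp (-n) := fun n => hbound n _ _ (hTy n) (hSz n)
  have hb : ∀ n, ‖b n‖ ≤ Real.exp (-n) := fun n => by
    have := hbound n _ _ (hSz n) (hTy n)
    rwa [add_comm] at this
  let U : ℕ → E →L[ℂ] H := fun n => InnerProductSpace.rankOne ℂ (a n) (e n)
  let V : ℕ → F →L[ℂ] H := fun n => InnerProductSpace.rankOne ℂ (b n) (f n)
  have hU : Summable U := Summable.of_norm_bounded Real.summable_exp_neg_nat fun n => by
    rw [InnerProductSpace.norm_rankOne, hy.1 n, mul_one]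
    exact ha n
  have hV : Summable V := Summable.of_norm_bounded Real.summable_exp_neg_nat fun n => by
    rw [InnerProductSpace.norm_rankOne, hz.1 n, mul_one]
    exact hb n
  have hUe : ∀ m n, m ≠ n → U m (e n) = 0 := fun m n hmn => by
    rw [InnerProductSpace.rankOne_apply, show ⟪e m, e n⟫_ℂ = 0 from hy.2 hmn, zero_smul]
  have hVf : ∀ m n, m ≠ n → V m (f n) = 0 := fun m n hmn => by
    rw [InnerProductSpace.rankOne_apply, show ⟪f m, f n⟫_ℂ = 0 from hz.2 hmn, zero_smul]
  let T' := T + ∑' n, U n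
  let S' := S + ∑' n, V n
  have hT'apply : ∀ x, T' x = T x + ∑' n, U n x := fun x => by
    simp only [T', add_apply]
    rw [← ContinuousLinearMap.apply_apply (𝕜 := ℂ) x (∑' n, U n),
      ContinuousLinearMap.map_tsum _ hU]
    rfl
  have hS'apply : ∀ x, S' x = S x + ∑' n, V n x := fun x => by
    simp only [S', add_apply]
    rw [← ContinuousLinearMap.apply_apply (𝕜 := ℂ) x (∑' n, V n),
      ContinuousLinearMap.map_tsum _ hV]
    rfl
  have hinnerU : ∀ (w : H) x, ⟪w, ∑' n, U n x⟫_ℂ = ∑' n, ⟪e n, x⟫_ℂ * ⟪w, a n⟫_ℂ := fun w x => by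
    have h1 : Summable fun n => U n x :=
      hU.map (ContinuousLinearMap.apply ℂ H x) (ContinuousLinearMap.apply ℂ H x).continuous
    rw [← innerSL_apply_apply ℂ w, ContinuousLinearMap.map_tsum _ h1]
    simp [U]
  have hinnerV : ∀ (w : H) x, ⟪w, ∑' n, V n x⟫_ℂ = ∑' n, ⟪f n, x⟫_ℂ * ⟪w, b n⟫_ℂ := fun w x => by
    have h1 : Summable fun n => V n x :=
      hV.map (ContinuousLinearMap.apply ℂ H x) (ContinuousLinearMap.apply ℂ H x).continuous
    rw [← innerSL_apply_apply ℂ w, ContinuousLinearMap.map_tsum _ h1]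
    simp [V]
  have hyT : ∀ n x, ⟪y n, T x⟫_ℂ = ⟪e n, x⟫_ℂ := fun n x =>
    (ContinuousLinearMap.adjoint_inner_left _ _ _).symm
  have hyS : ∀ n x, ⟪y n, S x⟫_ℂ = 0 := fun n x => by
    rw [← ContinuousLinearMap.adjoint_inner_left, hSy, inner_zero_left]
  have hzS : ∀ n x, ⟪z n, S x⟫_ℂ = ⟪f n, x⟫_ℂ := fun n x =>
    (ContinuousLinearMap.adjoint_inner_left _ _ _).symm
  have hzT : ∀ n x, ⟪z n, T x⟫_ℂ = 0 := fun n x => by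
    rw [← ContinuousLinearMap.adjoint_inner_left, hTz, inner_zero_left]
  have hee : ∀ m n, m ≠ n → ⟪e n, e m⟫_ℂ = 0 := fun m n hmn => hy.2 hmn.symm
  have hff : ∀ m n, m ≠ n → ⟪f n, f m⟫_ℂ = 0 := fun m n hmn => hz.2 hmn.symm
  -- Pairing with y n and z n reads off the coordinates along e n and f n, so T' and S' appear as
  -- the matrix (c s; s c), of determinant 1.
  have hyT' : ∀ n x, ⟪y n, T' x⟫_ℂ = c n * ⟪e n, x⟫_ℂ := fun n x => by
    rw [hT'apply, inner_add_right, hinnerU, hyT, tsum_eq_single n fun m hm => by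
      simp [a, hyT, hyS, hee m n hm]]
    simp [a, hyT, hyS, hy.1 n]
    ring
  have hyS' : ∀ n x, ⟪y n, S' x⟫_ℂ = s n * ⟪f n, x⟫_ℂ := fun n x => by
    rw [hS'apply, inner_add_right, hinnerV, hyS, tsum_eq_single n fun m hm => by
      simp [b, hyT, hyS, hee m n hm]]
    simp [b, hyT, hyS, hy.1 n]
    ring
  have hzT' : ∀ n x, ⟪z n, T' x⟫_ℂ = s n * ⟪e n, x⟫_ℂ := fun n x => by
    rw [hT'apply, inner_add_right, hinnerU, hzT, tsum_eq_single n fun m hm => by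
      simp [a, hzT, hzS, hff m n hm]]
    simp [a, hzT, hzS, hz.1 n]
    ring
  have hzS' : ∀ n x, ⟪z n, S' x⟫_ℂ = c n * ⟪f n, x⟫_ℂ := fun n x => by
    rw [hS'apply, inner_add_right, hinnerV, hzS, tsum_eq_single n fun m hm => by
      simp [b, hzT, hzS, hff m n hm]]
    simp [b, hzT, hzS, hz.1 n]
    ring
  have hinj' : Function.Injective (T'.coprod S') := by
    refine (injective_iff_map_eq_zero _).2 ?_
    rintro ⟨u, v⟩ huv
    rw [ContinuousLinearMap.coprod_apply] at huv
    -- Inverting these matrices annihilates all rotated coordinates of (u, v), and off them T' and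
    -- S' agree with T and S.
    have h1 : ∀ n, ⟪e n, u⟫_ℂ = 0 ∧ ⟪f n, v⟫_ℂ = 0 := fun n => by
      have e1 := congrArg (fun w => ⟪y n, w⟫_ℂ) huv
      have e2 := congrArg (fun w => ⟪z n, w⟫_ℂ) huv
      simp only [inner_add_right, hyT', hyS', hzT', hzS', inner_zero_right] at e1 e2
      constructor
      · linear_combination (-⟪e n, u⟫_ℂ) * hcs' n + c n * e1 - s n * e2
      · linear_combination (-⟪f n, v⟫_ℂ) * hcs' n - s n * e1 + c n * e2
    have h2 : T' u = T u := by
      rw [hT'apply]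
      simp [U, (h1 _).1]
    have h3 : S' v = S v := by
      rw [hS'apply]
      simp [V, (h1 _).2]
    rw [h2, h3] at huv
    exact hinj (by simpa using huv)
  refine ⟨T', S', hinj', ?_, fun hrange => ?_⟩
  · let TN : ℕ → E →L[ℂ] H := fun N => T + ∑ n ∈ Finset.range N, U n
    let SN : ℕ → F →L[ℂ] H := fun N => S + ∑ n ∈ Finset.range N, V n
    have hTN : Tendsto TN atTop (𝓝 T') := hU.hasSum.tendsto_sum_nat.const_add T
    have hSN : Tendsto SN atTop (𝓝 S') := hV.hasSum.tendsto_sum_nat.const_add S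
    -- Earlier rotations act in directions orthogonal to e N, so the next one still starts from T (e
    -- N).
    have hTe : ∀ N, TN N (e N) = T (e N) := fun N => by
      simp only [TN, add_apply, sum_apply]
      rw [Finset.sum_eq_zero fun n hn => hUe n N (Finset.mem_range.1 hn).ne, add_zero]
    have hSf : ∀ N, SN N (f N) = S (f N) := fun N => by
      simp only [SN, add_apply, sum_apply]
      rw [Finset.sum_eq_zero fun n hn => hVf n N (Finset.mem_range.1 hn).ne, add_zero]
    have hconst : ∀ N, TN N ∘L (TN N).adjoint - SN N ∘L (SN N).adjoint
        = T ∘L T.adjoint - S ∘L S.adjoint := fun N => by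
      induction N with
      | zero => simp [TN, SN]
      | succ N ih =>
        have h1 := comp_adjoint_sub_of_boost (TN N) (SN N) (hy.1 N) (hz.1 N) (hcs N)
        rw [ih, hTe, hSf] at h1
        rw [← h1]
        simp only [TN, SN, Finset.sum_range_succ, ← add_assoc]
        rfl
    have hadj : Tendsto (fun N => (TN N).adjoint) atTop (𝓝 T'.adjoint) :=
      (ContinuousLinearMap.adjoint.continuous.tendsto _).comp hTN
    have hadj' : Tendsto (fun N => (SN N).adjoint) atTop (𝓝 S'.adjoint) :=
      (ContinuousLinearMap.adjoint.continuous.tendsto _).comp hSN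
    have hlim := (((continuous_fst.clm_comp continuous_snd).tendsto _).comp
      (hTN.prodMk_nhds hadj)).sub (((continuous_fst.clm_comp continuous_snd).tendsto _).comp
      (hSN.prodMk_nhds hadj'))
    simp only [Function.comp_def] at hlim
    simp only [hconst] at hlim
    exact tendsto_nhds_unique hlim tendsto_const_nhds
  -- Inclusion of the ranges would give a bounded W acting on (e n, 0) as the inverse rotation, so
  -- ‖W‖ ≥ cosh n for every n.
  · obtain ⟨W, hW⟩ := exists_comp_eq_of_injective (T.coprod S) (T'.coprod S') hinj' hrange
    have hWe : ∀ n, W (e n, 0) = ((c n : ℂ) • e n, -(s n : ℂ) • f n) := fun n => by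
      refine hinj' ?_
      have h1 : T' (e n) = T (e n) + a n := by
        rw [hT'apply, tsum_eq_single n fun m hm => hUe m n hm]
        simp [U, hy.1 n]
      have h2 : S' (f n) = S (f n) + b n := by
        rw [hS'apply, tsum_eq_single n fun m hm => hVf m n hm]
        simp [V, hz.1 n]
      rw [hW, ContinuousLinearMap.coprod_apply, ContinuousLinearMap.coprod_apply]
      simp only [map_zero, add_zero, map_smul, h1, h2, a, b]
      push_cast
      match_scalars
      · linear_combination -hcs' n
      · ring
    have hn : ∀ n : ℕ, c n ≤ ‖W‖ := fun n => by
      have h1 := W.le_opNorm (e n, 0)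
      rw [hWe, Prod.norm_mk, Prod.norm_mk, norm_zero, hy.1 n, norm_smul, hy.1 n] at h1
      simp only [mul_one, zero_le_one, sup_of_le_left] at h1
      refine le_trans ?_ ((le_max_left _ _).trans h1)
      simpa using le_abs_self (c n)
    obtain ⟨n, hn'⟩ := exists_nat_gt (2 * ‖W‖)
    have h1 := hn n
    have h2 := Real.add_one_le_exp (n : ℝ)
    have h3 : Real.exp n ≤ 2 * c n := by
      rw [← hcsum n]
      have : s n ≤ c n := (Real.sinh_lt_cosh _).le
      linarith
    linarith

end Boost

/-! ### Approximate null vectors from spectral accumulation -/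

section Spectral

variable {H : Type*} [NormedAddCommGroup H] [InnerProductSpace ℂ H] [CompleteSpace H]

/-- The factor 4 keeps the intervals (l n / 2, 3 l n / 2) disjoint, as needed for bump functions
centred at the points l n. -/
theorem exists_seq_of_accumulation {σ : Set ℝ} (h : ∀ ε > 0, ∃ t ∈ σ, 0 < t ∧ t < ε) {δ : ℕ → ℝ}
    (hδ : ∀ n, 0 < δ n) :
    ∃ l : ℕ → ℝ, (∀ n, l n ∈ σ) ∧ (∀ n, 0 < l n) ∧ (∀ n, l n ≤ δ n) ∧
      ∀ m n, m < n → 4 * l n < l m := by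
  choose! p hp using h
  let l : ℕ → ℝ := fun n => Nat.rec (p (δ 0)) (fun k t => p (min (t / 4) (δ (k + 1)))) n
  have hs : ∀ n, l (n + 1) = p (min (l n / 4) (δ (n + 1))) := fun n => rfl
  have hpos : ∀ n, 0 < l n := fun n => by
    induction n with
    | zero => exact (hp _ (hδ 0)).2.1
    | succ n ih => exact (hp _ (lt_min (by positivity) (hδ _))).2.1
  have hmin : ∀ n, 0 < min (l n / 4) (δ (n + 1)) := fun n =>
    lt_min (by have := hpos n; positivity) (hδ _)
  have hlt : ∀ n, 4 * l (n + 1) < l n := fun n => by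
    have h1 := (hp _ (hmin n)).2.2
    rw [← hs] at h1
    linarith [h1.trans_le (min_le_left _ _)]
  refine ⟨l, fun n => ?_, hpos, fun n => ?_, fun m n hmn => ?_⟩
  · cases n with
    | zero => exact (hp _ (hδ 0)).1
    | succ n => exact (hp _ (hmin n)).1
  · cases n with
    | zero => exact (hp _ (hδ 0)).2.2.le
    | succ n => exact ((hp _ (hmin n)).2.2.trans_le (min_le_right _ _)).le
  · induction n, hmn using Nat.le_induction with
    | base => exact hlt m
    | succ k _ ih => linarith [hlt k, hpos k]

/-- Near an accumulation point of the spectrum at `0+` there are orthonormal sequences of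
approximate null vectors of the square root of the positive part. -/
theorem exists_orthonormal_of_accumulation {A : H →L[ℂ] H} (hA : IsSelfAdjoint A)
    (h : ∀ ε > 0, ∃ t ∈ spectrum ℝ A, 0 < t ∧ t < ε) {δ : ℕ → ℝ} (hδ : ∀ n, 0 < δ n) :
    ∃ y : ℕ → H, Orthonormal ℂ (fun n => cfc Real.sqrt A (y n)) ∧
      (∀ n, ‖cfc Real.sqrt A (cfc Real.sqrt A (y n))‖ ≤ δ n) ∧
      ∀ n, cfc (fun t : ℝ => √(-t)) A (y n) = 0 := by
  -- The bound δ²/2 is chosen so that √(2 l n) ≤ δ n.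
  obtain ⟨l, hσ, hl, hlδ, hlt⟩ := exists_seq_of_accumulation h
    (δ := fun n => δ n ^ 2 / 2) (fun n => by have := hδ n; positivity)
  let g : ℕ → ℝ → ℝ := fun n t => max 0 (l n / 2 - |t - l n|)
  have hgc : ∀ n, Continuous (g n) := fun n => by fun_prop
  have hg0 : ∀ n t, g n t ≠ 0 → l n / 2 < t ∧ t < 3 * l n / 2 := fun n t ht => by
    have h1 : |t - l n| < l n / 2 := by
      by_contra! hcon
      exact ht (max_eq_left (by linarith))
    rw [abs_lt] at h1
    constructor <;> linarith
  let u : ℕ → H →L[ℂ] H := fun n => cfc (fun t => √t * g n t) A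
  have hu : ∀ n, u n = cfc Real.sqrt A * cfc (g n) A := fun n =>
    cfc_mul _ _ A (by fun_prop) (hgc n).continuousOn
  -- The function defining u n does not vanish at the spectral point l n.
  have hu0 : ∀ n, ∃ v, u n v ≠ 0 := fun n => by
    by_contra! hcon
    have h1 : u n = 0 := ContinuousLinearMap.ext hcon
    have h2 : cfc (fun t => √t * g n t) A = cfc (fun _ : ℝ => (0 : ℝ)) A := by
      rw [cfc_const_zero]; exact h1
    rw [cfc_eq_cfc_iff_eqOn (hf := by have := hgc n; fun_prop)] at h2
    have h3 := h2 (hσ n)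
    have h4 := hl n
    have h5 : g n (l n) = l n / 2 := by simp [g, (half_pos h4).le]
    simp only [h5] at h3
    have : 0 < √(l n) * (l n / 2) := by positivity
    exact this.ne' h3
  choose v hv using hu0
  have hself : ∀ n, IsSelfAdjoint (u n) := fun n => IsSelfAdjoint.cfc
  have huu : ∀ m n, m ≠ n → u m * u n = 0 := fun m n hmn => by
    rw [← cfc_mul _ _ A (by have := hgc m; fun_prop) (by have := hgc n; fun_prop)]
    rw [← cfc_const_zero ℝ A]
    congr 1
    ext t
    by_contra hne
    have h1 := hg0 m t (by rintro h; simp [h] at hne)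
    have h2 := hg0 n t (by rintro h; simp [h] at hne)
    rcases lt_or_gt_of_ne hmn with h3 | h3
    · linarith [hlt _ _ h3, hl n, hl m]
    · linarith [hlt _ _ h3, hl n, hl m]
  let y : ℕ → H := fun n => ((‖u n (v n)‖⁻¹ : ℝ) : ℂ) • cfc (g n) A (v n)
  have hBy : ∀ n, cfc Real.sqrt A (y n) = ((‖u n (v n)‖⁻¹ : ℝ) : ℂ) • u n (v n) := fun n => by
    rw [map_smul, hu]
    rfl
  have hnorm : ∀ n, ‖cfc Real.sqrt A (y n)‖ = 1 := fun n => by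
    rw [hBy, norm_smul, Complex.norm_of_nonneg (by positivity),
      inv_mul_cancel₀ (norm_ne_zero_iff.2 (hv n))]
  refine ⟨y, ⟨hnorm, fun m n hmn => ?_⟩, fun n => ?_, fun n => ?_⟩
  · simp only [hBy]
    rw [inner_smul_left, inner_smul_right, ← ContinuousLinearMap.adjoint_inner_right,
      (ContinuousLinearMap.isSelfAdjoint_iff'.1 (hself m)),
      ← mul_apply_eq_comp, huu m n hmn]
    simp
  -- On the support of the bump t < 2 l n, so the root may be truncated there; the truncated root
  -- has norm at most δ n.
  · have h1 : cfc Real.sqrt A * u n = cfc (fun t => √(min t (2 * l n))) A * u n := by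
      rw [← cfc_mul _ _ A (by fun_prop) (by have := hgc n; fun_prop),
        ← cfc_mul _ _ A (by fun_prop) (by have := hgc n; fun_prop)]
      congr 1
      ext t
      by_cases ht : g n t = 0
      · simp [ht]
      · rw [min_eq_left (by linarith [(hg0 n t ht).2, hl n])]
    have h2 : cfc Real.sqrt A (cfc Real.sqrt A (y n))
        = cfc (fun t => √(min t (2 * l n))) A (cfc Real.sqrt A (y n)) := by
      rw [hBy, map_smul, map_smul, ← mul_apply_eq_comp, h1]
      rfl
    have h3 : ‖cfc (fun t => √(min t (2 * l n))) A‖ ≤ δ n := by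
      refine norm_cfc_le (hδ n).le fun t _ => ?_
      rw [Real.norm_of_nonneg (Real.sqrt_nonneg _)]
      refine Real.sqrt_le_iff.2 ⟨(hδ n).le, (min_le_right _ _).trans ?_⟩
      linarith [hlδ n]
    rw [h2]
    refine (ContinuousLinearMap.le_opNorm _ _).trans ?_
    rw [hnorm, mul_one]
    exact h3
  · have h1 : cfc (fun t : ℝ => √(-t)) A * cfc (g n) A = 0 := by
      rw [← cfc_mul _ _ A (by fun_prop) (hgc n).continuousOn, ← cfc_const_zero ℝ A]
      congr 1
      ext t
      by_cases ht : g n t = 0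
      · simp [ht]
      · rw [Real.sqrt_eq_zero_of_nonpos (by linarith [(hg0 n t ht).1, hl n]), zero_mul]
    rw [map_smul, ← mul_apply_eq_comp, h1]
    simp

/-- The restriction of `B` to the orthogonal complement of its kernel. -/
noncomputable def injectivePart (B : H →L[ℂ] H) :
    (LinearMap.ker B.toLinearMap)ᗮ →L[ℂ] H :=
  B ∘L (LinearMap.ker B.toLinearMap)ᗮ.subtypeL

/-- A selfadjoint B has its range in the orthogonal complement of its kernel, so the adjoint is B
with restricted codomain. -/
theorem coe_adjoint_injectivePart {B : H →L[ℂ] H} (hB : IsSelfAdjoint B) (w : H) :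
    ((injectivePart B).adjoint w : H) = B w := by
  have hs : ∀ x z, ⟪B x, z⟫_ℂ = ⟪x, B z⟫_ℂ := fun x z => by
    rw [← ContinuousLinearMap.adjoint_inner_right, ContinuousLinearMap.isSelfAdjoint_iff'.1 hB]
  have hmem : B w ∈ (LinearMap.ker B.toLinearMap)ᗮ := by
    rw [Submodule.mem_orthogonal]
    intro x hx
    rw [← hs, show B x = 0 from hx, inner_zero_left]
  have : (injectivePart B).adjoint w = ⟨B w, hmem⟩ := by
    refine ext_inner_left ℂ fun x => ?_
    rw [ContinuousLinearMap.adjoint_inner_right]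
    exact hs x w
  rw [this]

/-- Applying B to B x + C y = 0 removes the second term, and B² has the same kernel as B; likewise
for C. -/
theorem injectivePart_coprod_injective {B C : H →L[ℂ] H} (hB : IsSelfAdjoint B)
    (hC : IsSelfAdjoint C) (hBC : B * C = 0) (hCB : C * B = 0) :
    Function.Injective ((injectivePart B).coprod (injectivePart C)) := by
  have hs : ∀ {D : H →L[ℂ] H} (_ : IsSelfAdjoint D) {x : H}, x ∈ (LinearMap.ker D.toLinearMap)ᗮ →
      D (D x) = 0 → x = 0 := fun {D} hD {x} hx h => by
    have h1 : D x = 0 := by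
      rw [← inner_self_eq_zero (𝕜 := ℂ), ← ContinuousLinearMap.adjoint_inner_right,
        ContinuousLinearMap.isSelfAdjoint_iff'.1 hD, h, inner_zero_right]
    have h2 : x ∈ LinearMap.ker D.toLinearMap ⊓ (LinearMap.ker D.toLinearMap)ᗮ := ⟨h1, hx⟩
    rwa [Submodule.inf_orthogonal_eq_bot] at h2
  refine (injective_iff_map_eq_zero _).2 ?_
  rintro ⟨x, y⟩ hxy
  have hxy' : B x + C y = 0 := hxy
  have h1 : B (B x) = 0 := by
    have := congrArg B hxy'
    rwa [map_add, ← mul_apply_eq_comp B C, hBC, zero_apply,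
      add_zero, map_zero] at this
  have h2 : C (C y) = 0 := by
    have := congrArg C hxy'
    rwa [map_add, ← mul_apply_eq_comp C B, hCB, zero_apply,
      zero_add, map_zero] at this
  exact Prod.ext (Subtype.ext (hs hB x.2 h1)) (Subtype.ext (hs hC y.2 h2))

end Spectral

end Krein

namespace Krein

/-! ### The canonical space, the gap case and the accumulation case -/

section Existence

variable {H : Type*} [NormedAddCommGroup H] [InnerProductSpace ℂ H] [CompleteSpace H]
  {A : H →L[ℂ] H}

/-- The square root of the positive part of `A`. -/
noncomputable def sqrtPos (A : H →L[ℂ] H) : H →L[ℂ] H := cfc Real.sqrt A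

/-- The square root of the negative part of `A`. -/
noncomputable def sqrtNeg (A : H →L[ℂ] H) : H →L[ℂ] H := cfc (fun t : ℝ => √(-t)) A

theorem isSelfAdjoint_sqrtPos (A : H →L[ℂ] H) : IsSelfAdjoint (sqrtPos A) := IsSelfAdjoint.cfc

theorem isSelfAdjoint_sqrtNeg (A : H →L[ℂ] H) : IsSelfAdjoint (sqrtNeg A) := IsSelfAdjoint.cfc

theorem sqrt_mul_sqrt_neg (t : ℝ) : √t * √(-t) = 0 := by
  rcases le_total t 0 with h | h
  · rw [Real.sqrt_eq_zero_of_nonpos h, zero_mul]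
  · rw [Real.sqrt_eq_zero_of_nonpos (neg_nonpos.2 h), mul_zero]

theorem sqrtPos_mul_sqrtNeg (A : H →L[ℂ] H) : sqrtPos A * sqrtNeg A = 0 := by
  rw [sqrtPos, sqrtNeg, ← cfc_mul _ _ A, ← cfc_const_zero ℝ A]
  simp only [sqrt_mul_sqrt_neg]

theorem sqrtNeg_mul_sqrtPos (A : H →L[ℂ] H) : sqrtNeg A * sqrtPos A = 0 := by
  rw [sqrtPos, sqrtNeg, ← cfc_mul _ _ A, ← cfc_const_zero ℝ A]
  simp only [mul_comm √(-_), sqrt_mul_sqrt_neg]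

theorem sqrtPos_sq_sub_sqrtNeg_sq (hA : IsSelfAdjoint A) :
    sqrtPos A * sqrtPos A - sqrtNeg A * sqrtNeg A = A := by
  rw [sqrtPos, sqrtNeg, ← cfc_mul _ _ A, ← cfc_mul _ _ A, ← cfc_sub _ _ A]
  conv_rhs => rw [← cfc_id ℝ A]
  congr 1
  ext t
  rcases le_total t 0 with h | h
  · simp [Real.sqrt_eq_zero_of_nonpos h, Real.mul_self_sqrt (neg_nonneg.2 h)]
  · simp [Real.sqrt_eq_zero_of_nonpos (neg_nonpos.2 h), Real.mul_self_sqrt h]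

theorem sqrtPos_neg (hA : IsSelfAdjoint A) : sqrtPos (-A) = sqrtNeg A :=
  (cfc_comp_neg Real.sqrt A).symm

theorem sqrtNeg_neg (hA : IsSelfAdjoint A) : sqrtNeg (-A) = sqrtPos A := by
  rw [sqrtNeg, ← cfc_comp_neg (fun t : ℝ => √(-t)) A, sqrtPos]
  simp only [_root_.neg_neg]

theorem injectivePart_adjoint_apply {B : H →L[ℂ] H} (hB : IsSelfAdjoint B) (w : H) :
    injectivePart B ((injectivePart B).adjoint w) = B (B w) :=
  congrArg B (coe_adjoint_injectivePart hB w)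

theorem orthonormal_adjoint_injectivePart {B : H →L[ℂ] H} (hB : IsSelfAdjoint B) {y : ℕ → H}
    (hy : Orthonormal ℂ fun n => B (y n)) :
    Orthonormal ℂ fun n => (injectivePart B).adjoint (y n) := by
  have h : (fun n => B (y n)) = (LinearMap.ker B.toLinearMap)ᗮ.subtypeₗᵢ ∘
      fun n => (injectivePart B).adjoint (y n) :=
    funext fun n => (coe_adjoint_injectivePart hB (y n)).symm
  rw [h] at hy
  exact ((LinearMap.ker B.toLinearMap)ᗮ.subtypeₗᵢ.orthonormal_comp_iff).1 hy

theorem injectivePart_comp_adjoint_sub (hA : IsSelfAdjoint A) (w : H) :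
    injectivePart (sqrtPos A) ((injectivePart (sqrtPos A)).adjoint w) -
      injectivePart (sqrtNeg A) ((injectivePart (sqrtNeg A)).adjoint w) = A w := by
  rw [injectivePart_adjoint_apply (isSelfAdjoint_sqrtPos A),
    injectivePart_adjoint_apply (isSelfAdjoint_sqrtNeg A)]
  conv_rhs => rw [← sqrtPos_sq_sub_sqrtNeg_sq hA]
  rfl

theorem injectivePart_sqrt_injective (A : H →L[ℂ] H) :
    Function.Injective ((injectivePart (sqrtPos A)).coprod (injectivePart (sqrtNeg A))) :=
  injectivePart_coprod_injective (isSelfAdjoint_sqrtPos A) (isSelfAdjoint_sqrtNeg A)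
    (sqrtPos_mul_sqrtNeg A) (sqrtNeg_mul_sqrtPos A)

/-- A spectral gap to the right of `0` gives a Kreĭn space for which `ran ι^♯` contains a maximal
uniformly positive subspace. -/
theorem exists_maximal_le_range_of_gap (hA : IsSelfAdjoint A) {ε : ℝ} (hε : 0 < ε)
    (hgap : ∀ t ∈ Set.Ioo 0 ε, t ∉ spectrum ℝ A) :
    ∃ 𝒦 : EmbeddedKreinSpace H, 𝒦.IsAssociated A ∧ ∃ L : Submodule ℂ 𝒦.carrier,
      Maximal (IsUniformlyPositive 𝒦.form) L ∧ L ≤ LinearMap.range 𝒦.ιSharp := by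
  obtain ⟨𝒦, f, g, hm, hf, hg⟩ := EmbeddedKreinSpace.exists_isModel
    (injectivePart (sqrtPos A)) (injectivePart (sqrtNeg A)) (injectivePart_sqrt_injective A)
  have hass : 𝒦.IsAssociated A := (EmbeddedKreinSpace.isAssociated_iff_of_isModel hm hf hg).2
    (injectivePart_comp_adjoint_sub hA)
  refine ⟨𝒦, hass, LinearMap.range f, (hm.isFundamentalDecomposition).maximal, ?_⟩
  rintro _ ⟨x, rfl⟩
  -- A continuous q with t q(t) = √t on the spectrum: both sides vanish for t ≤ 0, and a positive
  -- spectral t satisfies t ≥ ε.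
  have hq : Continuous fun t : ℝ => √t / max t ε :=
    Real.continuous_sqrt.div (by fun_prop) fun t => (hε.trans_le (le_max_right t ε)).ne'
  have hfac : sqrtPos A = A * cfc (fun t : ℝ => √t / max t ε) A := by
    conv_rhs => enter [1]; rw [← cfc_id ℝ A]
    rw [← cfc_mul _ _ A (by fun_prop) hq.continuousOn, sqrtPos]
    refine cfc_congr fun t ht => ?_
    rcases le_or_gt t 0 with h0 | h0
    · simp [Real.sqrt_eq_zero_of_nonpos h0]
    · have h1 : ε ≤ t := by
        by_contra! h
        exact hgap t ⟨h0, h⟩ ht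
      simp only [id, max_eq_left h1]
      field_simp
  refine ⟨cfc (fun t : ℝ => √t / max t ε) A x, Subtype.ext ?_⟩
  rw [EmbeddedKreinSpace.isAssociated_iff.1 hass, hf]
  change _ = sqrtPos A x
  exact (DFunLike.congr_fun hfac (x : H)).symm

/-- If the spectrum accumulates at `0` from both sides, the associated Kreĭn space is not unique. -/
theorem exists_ne_of_accumulation (hA : IsSelfAdjoint A)
    (hpos : ∀ ε > 0, ∃ t ∈ spectrum ℝ A, 0 < t ∧ t < ε)
    (hneg : ∀ ε > 0, ∃ t ∈ spectrum ℝ (-A), 0 < t ∧ t < ε) :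
    ∃ 𝒦 𝒦' : EmbeddedKreinSpace H, 𝒦.IsAssociated A ∧ 𝒦'.IsAssociated A ∧ 𝒦 ≠ 𝒦' := by
  obtain ⟨y, hy, hyδ, hy0⟩ := exists_orthonormal_of_accumulation hA hpos
    (δ := fun n => Real.exp (-(2 * n))) fun n => Real.exp_pos _
  obtain ⟨z, hz, hzδ, hz0⟩ := exists_orthonormal_of_accumulation hA.neg hneg
    (δ := fun n => Real.exp (-(2 * n))) fun n => Real.exp_pos _
  change ∀ n, sqrtNeg A (y n) = 0 at hy0
  change ∀ n, sqrtNeg (-A) (z n) = 0 at hz0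
  change Orthonormal ℂ fun n => sqrtPos (-A) (z n) at hz
  change ∀ n, ‖sqrtPos (-A) (sqrtPos (-A) (z n))‖ ≤ _ at hzδ
  rw [sqrtPos_neg hA] at hz hzδ
  rw [sqrtNeg_neg hA] at hz0
  have hP := coe_adjoint_injectivePart (isSelfAdjoint_sqrtPos A)
  have hN := coe_adjoint_injectivePart (isSelfAdjoint_sqrtNeg A)
  have hinj := injectivePart_sqrt_injective A
  have hcomp := injectivePart_comp_adjoint_sub hA
  obtain ⟨T', S', hinj', hTS, hne⟩ := exists_range_ne_of_orthonormal hinj (y := y) (z := z)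
    (orthonormal_adjoint_injectivePart (isSelfAdjoint_sqrtPos A) hy)
    (orthonormal_adjoint_injectivePart (isSelfAdjoint_sqrtNeg A) hz)
    (fun n => Subtype.ext ((hN _).trans (hy0 n))) (fun n => Subtype.ext ((hP _).trans (hz0 n)))
    (fun n => by
      rw [injectivePart_adjoint_apply (isSelfAdjoint_sqrtPos A)]
      exact hyδ n)
    (fun n => by
      rw [injectivePart_adjoint_apply (isSelfAdjoint_sqrtNeg A)]
      exact hzδ n)
  obtain ⟨𝒦, f, g, hm, hf, hg⟩ := EmbeddedKreinSpace.exists_isModel _ _ hinj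
  obtain ⟨𝒦', f', g', hm', hf', hg'⟩ := EmbeddedKreinSpace.exists_isModel _ _ hinj'
  refine ⟨𝒦, 𝒦', (EmbeddedKreinSpace.isAssociated_iff_of_isModel hm hf hg).2 hcomp,
    (EmbeddedKreinSpace.isAssociated_iff_of_isModel hm' hf' hg').2 fun w => ?_, ?_⟩
  · rw [← hcomp]
    exact DFunLike.congr_fun hTS w
  -- Equal spaces would have equal carriers, but the carrier of 𝒦 is not contained in the range of
  -- the rotated pair.
  · rintro rfl
    refine hne fun p => ?_
    obtain ⟨x, x', hx⟩ := hm'.exists_add (f p.1 + g p.2)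
    refine ⟨(x, x'), ?_⟩
    have := congrArg Subtype.val hx
    rwa [Submodule.coe_add, Submodule.coe_add, hf, hg, hf', hg'] at this

end Existence

end Krein

/-! ### The equivalence -/

theorem corollary6p2 {H : Type*} [NormedAddCommGroup H] [InnerProductSpace ℂ H] [CompleteSpace H]
    (A : H →L[ℂ] H) (hA : IsSelfAdjoint A) :
    List.TFAE [
      ∃! 𝒦 : Krein.EmbeddedKreinSpace H, 𝒦.IsAssociated A,
      ∃ ε : ℝ, 0 < ε ∧
        ((∀ t ∈ Set.Ioo (-ε) 0, (t : ℂ) ∈ resolventSet ℂ A) ∨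
          (∀ t ∈ Set.Ioo 0 ε, (t : ℂ) ∈ resolventSet ℂ A)),
      ∃ 𝒦 : Krein.EmbeddedKreinSpace H, 𝒦.IsAssociated A ∧
        ∃ L : Submodule ℂ 𝒦.carrier, Krein.IsMaximalUniformlyDefinite 𝒦.form L ∧
          L ≤ LinearMap.range 𝒦.ιSharp] := by
  have hres : ∀ t : ℝ, (t : ℂ) ∈ resolventSet ℂ A ↔ t ∉ spectrum ℝ A := fun t => by
    rw [← spectrum.algebraMap_mem_iff ℂ, spectrum, Set.mem_compl_iff, not_not]
    rfl
  have hspec : ∀ t : ℝ, t ∈ spectrum ℝ (-A) ↔ -t ∈ spectrum ℝ A := fun t => by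
    rw [← spectrum.neg_eq, Set.mem_neg]
  tfae_have 1 → 2 := by
    rintro ⟨𝒦₀, -, huniq⟩
    by_contra! hcon
    obtain ⟨𝒦, 𝒦', h, h', hne⟩ := Krein.exists_ne_of_accumulation hA
      (fun ε hε => by
        obtain ⟨t, ht, hts⟩ := (hcon ε hε).2
        rw [hres, not_not] at hts
        exact ⟨t, hts, ht⟩)
      (fun ε hε => by
        obtain ⟨t, ht, hts⟩ := (hcon ε hε).1
        rw [hres, not_not] at hts
        exact ⟨-t, by rwa [hspec, neg_neg], by linarith [ht.2], by linarith [ht.1]⟩)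
    exact hne ((huniq 𝒦 h).trans (huniq 𝒦' h').symm)
  tfae_have 2 → 3 := by
    rintro ⟨ε, hε, h | h⟩
    -- A gap to the left of 0 for A is one to the right for -A; reversing the form makes L uniformly
    -- negative.
    · obtain ⟨𝒦, hK, L, hL, hLr⟩ := Krein.exists_maximal_le_range_of_gap hA.neg hε
        (fun t ht => by
          rw [hspec, ← hres]
          exact h (-t) ⟨neg_lt_neg ht.2, neg_lt_zero.2 ht.1⟩)
      refine ⟨𝒦.neg, by simpa using hK.neg, L, Or.inr ?_, ?_⟩
      · rw [← Krein.isUniformlyPositive_neg]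
        change Maximal (Krein.IsUniformlyPositive (- -𝒦.form)) L
        rwa [neg_neg]
      · exact hLr.trans_eq 𝒦.range_neg_ιSharp.symm
    · obtain ⟨𝒦, hK, L, hL, hLr⟩ := Krein.exists_maximal_le_range_of_gap hA hε
        (fun t ht => (hres t).1 (h t ht))
      exact ⟨𝒦, hK, L, Or.inl hL, hLr⟩
  tfae_have 3 → 1 := by
    rintro ⟨𝒦, hK, L, hL | hL, hLr⟩
    · exact ⟨𝒦, hK, fun 𝒦' h' => (Krein.EmbeddedKreinSpace.eq_of_maximal_le_range hK h' hL hLr).symm⟩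
    · refine ⟨𝒦, hK, fun 𝒦' h' => ?_⟩
      rw [← Krein.isUniformlyPositive_neg] at hL
      have := Krein.EmbeddedKreinSpace.eq_of_maximal_le_range (𝒦 := 𝒦.neg) hK.neg h'.neg hL
        (hLr.trans_eq 𝒦.range_neg_ιSharp.symm)
      rw [← 𝒦.neg_neg, this, 𝒦'.neg_neg]
  tfae_finish
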